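/- Let $k$ be an algebraically closed field and let $X$ be a non-singular curve over $k$, i.e. a separated scheme of finite type over $k$ whose local rings at closed points are regular of dimension $1$ ($X$ need not be irreducible). Let $p$ be a closed point of $X$. By a (not necessarily flat) family of algebras over $X$ we mean a sheaf $\mathcal A$ of associative unital (not necessarily commutative) $\mathcal O_X$-algebras that is coherent as a sheaf of $\mathcal O_X$-modules; its fibre at a closed point $x$ is the $k$-algebra $\mathcal A(x)=\mathcal A_x/\mathfrak m_x\mathcal A_x$, where $\mathfrak m_x$ is the maximal ideal of $\mathcal O_{X,x}$. The family is called flat if $\mathcal A$ is flat as a sheaf of $\mathcal O_X$-modules. Let $\mathbf A$ and $\mathbf B$ be $k$-algebras, and let $\mathcal A$ be a (not necessarily flat) family of algebras over $X$ such that $\mathcal A(x)\simeq\mathbf B$ as $k$-algebras for all closed points $x\ne p$, while $\mathcal A(p)\simeq\mathbf A$. Then there is a flat family of algebras $\mathcal B$ over $X$ such that $\mathcal B(x)\simeq\mathbf B$ for all closed points $x\neq p$ and $\mathcal B(p)\simeq\mathbf A/I$ for some two-sided ideal $I$ of $\mathbf A$. -/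

import Mathlib

open CategoryTheory AlgebraicGeometry Opposite

universe u v w

noncomputable section

/-- A sheaf of (associative, unital, not necessarily commutative) `𝒪_X`-algebras on a scheme `X`:
a sheaf of rings together with a morphism of sheaves of rings from `𝒪_X` to it
whose image is central. -/
structure AlgebraSheaf (X : Scheme.{u}) where
  /-- the underlying sheaf of rings -/
  sheaf : Sheaf (Opens.grothendieckTopology X) RingCat.{u}
  /-- the structure morphism `𝒪_X ⟶ 𝒜` -/
  structureHom : X.ringCatSheaf ⟶ sheaf
  /-- the image of `𝒪_X` is central -/
  central : ∀ (U : X.Opens) (a : X.ringCatSheaf.obj.obj (op U)) (s : sheaf.obj.obj (op U)),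
    Commute ((structureHom.hom.app (op U)).hom a) s

namespace AlgebraSheaf

variable {X : Scheme.{u}} (𝒜 : AlgebraSheaf X)

/-- The sheaf of `𝒪_X`-modules underlying a sheaf of `𝒪_X`-algebras: the sheaf `𝒜` as a module over
itself, with scalars restricted along `𝒪_X ⟶ 𝒜`. -/
def toModules : X.Modules :=
  (SheafOfModules.restrictScalars 𝒜.structureHom).obj (SheafOfModules.unit 𝒜.sheaf)

/-- Coherence of the underlying sheaf of `𝒪_X`-modules (for locally noetherian `X`):
it is quasi-coherent and of finite type. -/
class IsCoherent : Prop where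
  isQuasicoherent : 𝒜.toModules.IsQuasicoherent
  isFiniteType : 𝒜.toModules.IsFiniteType

/-- The underlying presheaf of rings. -/
abbrev presheaf : TopCat.Presheaf RingCat.{u} X := 𝒜.sheaf.obj

/-- The stalk `𝒜_x`, a ring. -/
abbrev Stalk (x : X) : Type u := 𝒜.presheaf.stalk x

/-- The ring homomorphism `𝒪_{X,x} → 𝒜_x` induced on stalks by the structure morphism. -/
def stalkHom (x : X) : X.presheaf.stalk x →+* 𝒜.Stalk x :=
  ((preservesColimitIso (forget₂ CommRingCat RingCat)
      ((TopologicalSpace.OpenNhds.inclusion x).op ⋙ X.presheaf)).hom ≫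
    (TopCat.Presheaf.stalkFunctor RingCat x).map 𝒜.structureHom.hom).hom

theorem stalkHom_germ (x : X) (U : X.Opens) (hx : x ∈ U) (a : X.presheaf.obj (op U)) :
    𝒜.stalkHom x (X.presheaf.germ U x hx a) =
      𝒜.presheaf.germ U x hx (𝒜.structureHom.hom.app (op U) a) := by
  have h1 : (forget₂ CommRingCat RingCat).map (X.presheaf.germ U x hx) ≫
      (preservesColimitIso (forget₂ CommRingCat RingCat)
      ((TopologicalSpace.OpenNhds.inclusion x).op ⋙ X.presheaf)).hom =
      TopCat.Presheaf.germ (C := RingCat) X.ringCatSheaf.obj U x hx :=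
    ι_preservesColimitIso_hom (forget₂ CommRingCat RingCat)
      ((TopologicalSpace.OpenNhds.inclusion x).op ⋙ X.presheaf) (op ⟨U, hx⟩)
  have h2 := TopCat.Presheaf.stalkFunctor_map_germ U x hx 𝒜.structureHom.hom
  have h3 : (forget₂ CommRingCat RingCat).map (X.presheaf.germ U x hx) ≫
      ((preservesColimitIso (forget₂ CommRingCat RingCat)
      ((TopologicalSpace.OpenNhds.inclusion x).op ⋙ X.presheaf)).hom ≫
      (TopCat.Presheaf.stalkFunctor RingCat x).map 𝒜.structureHom.hom) =
      𝒜.structureHom.hom.app (op U) ≫ 𝒜.presheaf.germ U x hx := by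
    rw [← h2, ← h1]
    exact (Category.assoc _ _ _).symm
  exact congr($(h3).hom a)

theorem stalkHom_central (x : X) (a : X.presheaf.stalk x) (s : 𝒜.Stalk x) :
    Commute (𝒜.stalkHom x a) s := by
  obtain ⟨U, hU, a, rfl⟩ := TopCat.Presheaf.exists_germ_eq X.presheaf a
  obtain ⟨V, hV, s, rfl⟩ := TopCat.Presheaf.exists_germ_eq 𝒜.presheaf s
  have hUV : x ∈ U ⊓ V := ⟨hU, hV⟩
  rw [← X.presheaf.germ_res_apply (TopologicalSpace.Opens.infLELeft U V) x hUV a,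
    ← 𝒜.presheaf.germ_res_apply (TopologicalSpace.Opens.infLERight U V) x hUV s]
  have h := (𝒜.central (U ⊓ V) (X.presheaf.map (TopologicalSpace.Opens.infLELeft U V).op a)
    (𝒜.presheaf.map (TopologicalSpace.Opens.infLERight U V).op s)).map
    (𝒜.presheaf.germ (U ⊓ V) x hUV).hom
  exact (congrArg (fun y => Commute y _) (𝒜.stalkHom_germ x (U ⊓ V) hUV _)).mpr h

instance (x : X) : Algebra (X.presheaf.stalk x) (𝒜.Stalk x) :=
  (𝒜.stalkHom x).toAlgebra' fun a s => 𝒜.stalkHom_central x a s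

/-- Flatness of the underlying sheaf of `𝒪_X`-modules: every stalk `𝒜_x` is flat over `𝒪_{X,x}`. -/
class IsFlat : Prop where
  flat_stalk : ∀ x : X, Module.Flat (X.presheaf.stalk x) (𝒜.Stalk x)

/-- The two-sided ideal `𝔪_x 𝒜_x` of `𝒜_x`. -/
def fibreIdeal (x : X) : Ideal (𝒜.Stalk x) :=
  (IsLocalRing.maximalIdeal (X.presheaf.stalk x)).map
    (algebraMap (X.presheaf.stalk x) (𝒜.Stalk x))

instance (x : X) : (𝒜.fibreIdeal x).IsTwoSided where
  mul_mem_of_left {a} b ha := by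
    refine Submodule.span_induction (p := fun y _ => y * b ∈ 𝒜.fibreIdeal x) ?_ ?_ ?_ ?_ ha
    · rintro _ ⟨r, hr, rfl⟩
      rw [Algebra.commutes r b]
      exact Ideal.mul_mem_left _ _ (Ideal.mem_map_of_mem _ hr)
    · simp
    · intro y z _ _ hy hz
      rw [add_mul]
      exact add_mem hy hz
    · intro c y _ hy
      rw [smul_eq_mul, mul_assoc]
      exact Ideal.mul_mem_left _ _ hy

/-- The fibre `𝒜(x) = 𝒜_x / 𝔪_x 𝒜_x`, a ring. -/
abbrev Fibre (x : X) : Type u := 𝒜.Stalk x ⧸ 𝒜.fibreIdeal x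

end AlgebraSheaf

section OverField

variable (k : Type u) [Field k] (X : Scheme.{u}) [X.Over (Spec (.of k))]

/-- For a scheme `X` over a field `k`, the ring homomorphism `k → 𝒪_{X,x}` that makes the local ring
at `x` a `k`-algebra. -/
def baseToStalk (x : X) : k →+* X.presheaf.stalk x :=
  ((Scheme.ΓSpecIso (.of k)).inv ≫ (X ↘ Spec (.of k)).appTop ≫
    X.presheaf.germ ⊤ x trivial).hom

instance AlgebraSheaf.algebraBaseStalk {k : Type u} [Field k] {X : Scheme.{u}}
    [X.Over (Spec (.of k))] (𝒜 : AlgebraSheaf X) (x : X) : Algebra k (𝒜.Stalk x) :=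
  ((algebraMap (X.presheaf.stalk x) (𝒜.Stalk x)).comp (baseToStalk k X x)).toAlgebra'
    fun c s => 𝒜.stalkHom_central x (baseToStalk k X x c) s

/-- A non-singular curve over `k`: a separated scheme of finite type over `k` whose local rings at
closed points are regular of dimension one. (It need not be irreducible.) -/
class IsNonsingularCurve : Prop where
  isSeparated : IsSeparated (X ↘ Spec (.of k))
  locallyOfFiniteType : LocallyOfFiniteType (X ↘ Spec (.of k))
  quasiCompact : QuasiCompact (X ↘ Spec (.of k))
  isRegularLocalRing_stalk : ∀ x : X, IsClosed {x} → IsRegularLocalRing (X.presheaf.stalk x)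
  ringKrullDim_stalk : ∀ x : X, IsClosed {x} → ringKrullDim (X.presheaf.stalk x) = 1

end OverField

end

noncomputable section

/-! Let `j` be the inclusion of `X \ {p}`. Take for the new family the image of `𝒜` in `j_* j^* 𝒜`,
that is, `𝒜` modulo its sections supported at `p` (`punctureImage`). These sections form a two-sided
ideal, so the quotient is again an algebra sheaf. Its stalks and fibres away from `p` are those of
`𝒜`, and its fibre at `p` is a quotient of `𝒜(p)`.

Flatness is checked point by point in `punctureImage_isFlat`. At `p` the uniformizer acts
injectively on the quotient (`isSMulRegular_stalk_punctureImage`), which suffices over a discrete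
valuation ring. At the other closed points the fibres all have dimension `dim B`, so `𝒜` is free
there: lift a basis of the fibre by Nakayama; a nontrivial relation would have a coefficient
invertible at some nearby closed point, whose fibre would then be too small
(`free_stalk_of_finrank_fibre_eq`). At a non-closed point the local ring is a field.

For coherence, finite type passes to quotients. Quasi-coherence is tested by localization on affine
opens `U` with `U \ {p} = D(a)`. Such a local equation `a` exists near `p` because the maximal ideal
there is principal (`exists_basicOpen_eq_inf_puncture`). -/

/-- The open complement of a closed point. -/
def AlgebraicGeometry.Scheme.puncture {X : Scheme.{u}} {p : X} (hp : IsClosed {p}) : X.Opens :=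
  ⟨{p}ᶜ, hp.isOpen_compl⟩

/-! ### The quotient by sections supported at a closed point -/

namespace AlgebraSheaf

variable {X : Scheme.{u}} (𝒜 : AlgebraSheaf X)

/-- Restriction of sections of an algebra sheaf. -/
def res {U V : X.Opens} (h : V ≤ U) : 𝒜.sheaf.obj.obj (op U) →+* 𝒜.sheaf.obj.obj (op V) :=
  (𝒜.sheaf.obj.map (homOfLE h).op).hom

@[simp]
theorem res_res {U V W : X.Opens} (h : V ≤ U) (h' : W ≤ V) (s : 𝒜.sheaf.obj.obj (op U)) :
    𝒜.res h' (𝒜.res h s) = 𝒜.res (h'.trans h) s := by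
  have := 𝒜.sheaf.obj.map_comp (homOfLE h).op (homOfLE h').op
  exact congr($(this).hom s).symm

@[simp]
theorem res_self {U : X.Opens} (h : U ≤ U) (s : 𝒜.sheaf.obj.obj (op U)) :
    𝒜.res h s = s :=
  congr($(𝒜.sheaf.obj.map_id (op U)).hom s)

theorem eq_of_locally_eq {ι : Type*} (U : ι → X.Opens) {V : X.Opens} (hU : ∀ i, U i ≤ V)
    (hV : V ≤ iSup U) (s t : 𝒜.sheaf.obj.obj (op V))
    (h : ∀ i, 𝒜.res (hU i) s = 𝒜.res (hU i) t) : s = t :=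
  TopCat.Sheaf.eq_of_locally_eq' (X := X) 𝒜.sheaf U V (fun i => homOfLE (hU i)) hV s t h

theorem exists_gluing {ι : Type*} (U : ι → X.Opens) {V : X.Opens} (hU : ∀ i, U i ≤ V)
    (hV : V ≤ iSup U) (s : ∀ i, 𝒜.sheaf.obj.obj (op (U i)))
    (h : ∀ i j, 𝒜.res (inf_le_left : U i ⊓ U j ≤ U i) (s i) =
      𝒜.res (inf_le_right : U i ⊓ U j ≤ U j) (s j)) :
    ∃ t : 𝒜.sheaf.obj.obj (op V), ∀ i, 𝒜.res (hU i) t = s i :=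
  (TopCat.Sheaf.existsUnique_gluing' (X := X) 𝒜.sheaf U V (fun i => homOfLE (hU i)) hV s h).exists

theorem exists_gluing₂ {U V W : X.Opens} (hU : U ≤ W) (hV : V ≤ W) (hW : W ≤ U ⊔ V)
    (s : 𝒜.sheaf.obj.obj (op U)) (t : 𝒜.sheaf.obj.obj (op V))
    (h : 𝒜.res (inf_le_left : U ⊓ V ≤ U) s = 𝒜.res (inf_le_right : U ⊓ V ≤ V) t) :
    ∃ r : 𝒜.sheaf.obj.obj (op W), 𝒜.res hU r = s ∧ 𝒜.res hV r = t := by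
  let O : Bool → X.Opens := fun b => bif b then U else V
  obtain ⟨r, hr⟩ := 𝒜.exists_gluing O (V := W) (by rintro (_ | _) <;> assumption)
    (hW.trans (sup_le (le_iSup O true) (le_iSup O false))) (fun b => match b with
      | true => s
      | false => t) (by
        rintro (_ | _) (_ | _)
        · rfl
        · have := congr(𝒜.res (inf_comm V U).le $h)
          simp only [res_res] at this
          exact this.symm
        · exact h
        · rfl)
  exact ⟨r, hr true, hr false⟩

theorem structureHom_res {U V : X.Opens} (h : V ≤ U) (a : X.presheaf.obj (op U)) :
    𝒜.structureHom.hom.app (op V) (X.presheaf.map (homOfLE h).op a) =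
      𝒜.res h (𝒜.structureHom.hom.app (op U) a) :=
  congr($(𝒜.structureHom.hom.naturality (homOfLE h).op).hom a)

section Puncture

variable {p : X} (hp : IsClosed {p})

open Scheme (puncture)

/-- Restriction of sections to the complement of `p`. -/
def resPuncture (U : X.Opens) :
    𝒜.sheaf.obj.obj (op U) →+* 𝒜.sheaf.obj.obj (op (U ⊓ puncture hp)) :=
  𝒜.res inf_le_left

/-- The presheaf of rings of sections away from `p` which extend over `p`. -/
def punctureImagePresheaf : TopCat.Presheaf RingCat.{u} X where
  obj U := .of (𝒜.resPuncture hp U.unop).range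
  map {U V} i := RingCat.ofHom <|
    ((𝒜.res (inf_le_inf_right _ i.unop.le)).comp (𝒜.resPuncture hp U.unop).range.subtype).codRestrict
      (𝒜.resPuncture hp V.unop).range (by
        rintro ⟨_, s, rfl⟩
        exact ⟨𝒜.res i.unop.le s, (𝒜.res_res _ _ _).trans (𝒜.res_res _ _ _).symm⟩)
  map_id U := by
    refine RingCat.hom_ext (RingHom.ext fun x => Subtype.ext ?_)
    exact 𝒜.res_self _ (show (𝒜.resPuncture hp U.unop).range from x).1
  map_comp {U V W} i j := by
    refine RingCat.hom_ext (RingHom.ext fun x => Subtype.ext ?_)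
    exact (𝒜.res_res _ _ (show (𝒜.resPuncture hp U.unop).range from x).1).symm

/-- No sheafification is needed, because only one point is removed. Sections glue to some `t` on the
punctured union. If `p` lies in `U i`, a lift of `s i` to `U i` agrees with `t` off `p`, and the two
glue over all of `iSup U`. -/
theorem punctureImagePresheaf_isSheaf : (𝒜.punctureImagePresheaf hp).IsSheaf := by
  rw [TopCat.Presheaf.isSheaf_iff_isSheaf_comp (forget RingCat)]
  refine TopCat.Presheaf.isSheaf_of_isSheafUniqueGluing_types _ fun {ι} U sf hsf => ?_
  have hle (i : ι) : U i ⊓ puncture hp ≤ iSup U ⊓ puncture hp := inf_le_inf_right _ (le_iSup U i)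
  have hcov : iSup U ⊓ puncture hp ≤ ⨆ i, U i ⊓ puncture hp := (iSup_inf_eq U _).le
  let s (i : ι) : (𝒜.resPuncture hp (U i)).range := sf i
  have hs (i j : ι) : 𝒜.res (inf_le_inf_right (puncture hp) (inf_le_left : U i ⊓ U j ≤ U i)) (s i).1 =
      𝒜.res (inf_le_inf_right (puncture hp) (inf_le_right : U i ⊓ U j ≤ U j)) (s j).1 :=
    congrArg Subtype.val (hsf i j)
  obtain ⟨t, ht⟩ := 𝒜.exists_gluing _ hle hcov (fun i => (s i).1) (fun i j => by
    have := congr(𝒜.res (show (U i ⊓ puncture hp) ⊓ (U j ⊓ puncture hp) ≤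
      (U i ⊓ U j) ⊓ puncture hp from (inf_inf_distrib_right _ _ _).ge) $(hs i j))
    simpa only [res_res] using this)
  have hmem : t ∈ (𝒜.resPuncture hp (iSup U)).range := by
    by_cases hpU : p ∈ iSup U
    · obtain ⟨i, hi⟩ := TopologicalSpace.Opens.mem_iSup.mp hpU
      obtain ⟨r, hr⟩ := (s i).2
      obtain ⟨y, hy, -⟩ := 𝒜.exists_gluing₂ (U := iSup U ⊓ puncture hp) (V := U i) (W := iSup U)
        inf_le_left (le_iSup U i) (fun x hx => by
          by_cases hxp : x = p
          · exact Or.inr (hxp ▸ hi)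
          · exact Or.inl ⟨hx, hxp⟩) t r (by
          have h1 := congr(𝒜.res (show (iSup U ⊓ puncture hp) ⊓ U i ≤ U i ⊓ puncture hp from
            fun x hx => ⟨hx.2, hx.1.2⟩) $((ht i).trans hr.symm))
          simpa only [resPuncture, res_res] using h1)
      exact ⟨y, hy⟩
    · exact ⟨𝒜.res (show iSup U ≤ iSup U ⊓ puncture hp from
        fun x hx => ⟨hx, fun h => hpU (h ▸ hx)⟩) t, by simp [resPuncture]⟩
  refine ⟨(⟨t, hmem⟩ : (𝒜.resPuncture hp (iSup U)).range), fun i => Subtype.ext (ht i), ?_⟩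
  intro t' ht'
  have ht'' (i : ι) : 𝒜.res (hle i)
      (show (𝒜.resPuncture hp (iSup U)).range from t').1 = (s i).1 :=
    congrArg Subtype.val (ht' i)
  exact Subtype.ext (𝒜.eq_of_locally_eq _ hle hcov _ _ fun i => (ht'' i).trans (ht i).symm)

/-- The quotient of an algebra sheaf by its sections supported at the closed point `p`. -/
def punctureImage : AlgebraSheaf X where
  sheaf := ⟨𝒜.punctureImagePresheaf hp, 𝒜.punctureImagePresheaf_isSheaf hp⟩
  structureHom := ⟨{
    app U := RingCat.ofHom ((𝒜.resPuncture hp U.unop).rangeRestrict.comp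
      (𝒜.structureHom.hom.app U).hom)
    naturality U V i := by
      ext a
      refine Subtype.ext ?_
      change 𝒜.res _ (𝒜.structureHom.hom.app _ _) = 𝒜.res _ (𝒜.res _ _)
      rw [res_res]
      have := 𝒜.structureHom_res i.unop.le a
      exact congr(𝒜.res inf_le_left $this).trans (𝒜.res_res _ _ _) }⟩
  central := by
    rintro U a ⟨_, s, rfl⟩
    exact (𝒜.central U a s).map (𝒜.resPuncture hp U).rangeRestrict

/-- The quotient map to `punctureImage`. -/
def toPunctureImage : 𝒜.sheaf ⟶ (𝒜.punctureImage hp).sheaf :=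
  ⟨{ app U := RingCat.ofHom (𝒜.resPuncture hp U.unop).rangeRestrict
     naturality U V i := by
      ext a
      refine Subtype.ext ?_
      change 𝒜.res _ (𝒜.res _ _) = 𝒜.res _ (𝒜.res _ _)
      simp only [res_res] }⟩

theorem structureHom_toPunctureImage :
    𝒜.structureHom ≫ 𝒜.toPunctureImage hp = (𝒜.punctureImage hp).structureHom := rfl

theorem toPunctureImage_surjective (U : X.Opens) :
    Function.Surjective ((𝒜.toPunctureImage hp).hom.app (op U)) :=
  (𝒜.resPuncture hp U).rangeRestrict_surjective

theorem toPunctureImage_eq_zero_iff (U : X.Opens) (s : 𝒜.sheaf.obj.obj (op U)) :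
    (𝒜.toPunctureImage hp).hom.app (op U) s = 0 ↔
      𝒜.res (inf_le_left : U ⊓ puncture hp ≤ U) s = 0 :=
  Subtype.ext_iff

theorem toPunctureImage_injective (U : X.Opens) (hU : p ∉ U) :
    Function.Injective ((𝒜.toPunctureImage hp).hom.app (op U)) := by
  rw [injective_iff_map_eq_zero]
  intro s hs
  rw [toPunctureImage_eq_zero_iff] at hs
  have h : U ≤ U ⊓ puncture hp := fun x hx => ⟨hx, fun h => hU (h ▸ hx)⟩
  simpa using congr(𝒜.res h $hs)

end Puncture

end AlgebraSheaf

end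

noncomputable section

/-! ### Stalks and fibres of morphisms of algebra sheaves -/

namespace AlgebraSheaf

variable {X : Scheme.{u}} (𝒜 ℬ : AlgebraSheaf X)

instance algebraSections (U : X.Opens) :
    Algebra (X.presheaf.obj (op U)) (𝒜.sheaf.obj.obj (op U)) :=
  RingHom.toAlgebra' (𝒜.structureHom.hom.app (op U)).hom fun a s => 𝒜.central U a s

theorem res_smul {U V : X.Opens} (h : V ≤ U) (a : X.presheaf.obj (op U))
    (s : 𝒜.sheaf.obj.obj (op U)) :
    𝒜.res h (a • s) = X.presheaf.map (homOfLE h).op a • 𝒜.res h s := by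
  refine (map_mul (𝒜.res h) _ _).trans ?_
  exact congrArg (· * 𝒜.res h s) (𝒜.structureHom_res h a).symm

/-- The germ of a section of an algebra sheaf. -/
def germ (U : X.Opens) (x : X) (hx : x ∈ U) : 𝒜.sheaf.obj.obj (op U) →+* 𝒜.Stalk x :=
  (𝒜.presheaf.germ U x hx).hom

@[simp]
theorem germ_res {U V : X.Opens} (h : V ≤ U) (x : X) (hx : x ∈ V) (s : 𝒜.sheaf.obj.obj (op U)) :
    𝒜.germ V x hx (𝒜.res h s) = 𝒜.germ U x (h hx) s :=
  𝒜.presheaf.germ_res_apply (homOfLE h) x hx s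

theorem exists_le_germ_eq {x : X} (t : 𝒜.Stalk x) {V : X.Opens} (hV : x ∈ V) :
    ∃ U ≤ V, ∃ (hx : x ∈ U) (s : 𝒜.sheaf.obj.obj (op U)), 𝒜.germ U x hx s = t :=
  𝒜.presheaf.exists_le_germ_eq t hV

theorem exists_le_res_eq_zero {x : X} {U : X.Opens} (hx : x ∈ U) (s : 𝒜.sheaf.obj.obj (op U))
    (h : 𝒜.germ U x hx s = 0) : ∃ (V : X.Opens) (hV : V ≤ U), x ∈ V ∧ 𝒜.res hV s = 0 := by
  obtain ⟨W, hW, i, j, e⟩ := 𝒜.presheaf.germ_eq x hx hx s 0 (h.trans (map_zero (𝒜.germ U x hx)).symm)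
  exact ⟨W, i.le, hW, e.trans (map_zero (𝒜.res j.le))⟩

theorem germ_smul {U : X.Opens} (x : X) (hx : x ∈ U) (a : X.presheaf.obj (op U))
    (s : 𝒜.sheaf.obj.obj (op U)) :
    𝒜.germ U x hx (a • s) = X.presheaf.germ U x hx a • 𝒜.germ U x hx s := by
  refine (map_mul (𝒜.germ U x hx) _ _).trans ?_
  exact congrArg (· * 𝒜.germ U x hx s) (𝒜.stalkHom_germ x U hx a).symm

section StalkMap

variable {𝒜 ℬ} (f : 𝒜.sheaf ⟶ ℬ.sheaf) (hf : 𝒜.structureHom ≫ f = ℬ.structureHom)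

/-- The map on sections of a morphism of algebra sheaves. -/
def sectionMap (U : X.Opens) : 𝒜.sheaf.obj.obj (op U) →+* ℬ.sheaf.obj.obj (op U) :=
  (f.hom.app (op U)).hom

theorem res_sectionMap {U V : X.Opens} (h : V ≤ U) (s : 𝒜.sheaf.obj.obj (op U)) :
    sectionMap f V (𝒜.res h s) = ℬ.res h (sectionMap f U s) :=
  congr($(f.hom.naturality (homOfLE h).op).hom s)

/-- The map on stalks of a morphism of algebra sheaves. -/
def stalkRingHom (x : X) : 𝒜.Stalk x →+* ℬ.Stalk x :=
  ((TopCat.Presheaf.stalkFunctor RingCat x).map f.hom).hom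

theorem stalkRingHom_germ (U : X.Opens) (x : X) (hx : x ∈ U) (s : 𝒜.sheaf.obj.obj (op U)) :
    stalkRingHom f x (𝒜.germ U x hx s) = ℬ.germ U x hx (sectionMap f U s) :=
  congr($(TopCat.Presheaf.stalkFunctor_map_germ U x hx f.hom).hom s)

theorem stalkRingHom_surjective (h : ∀ U, Function.Surjective (sectionMap f U)) (x : X) :
    Function.Surjective (stalkRingHom f x) := by
  intro t
  obtain ⟨U, -, hx, s, rfl⟩ := ℬ.exists_le_germ_eq t (TopologicalSpace.Opens.mem_top x)
  obtain ⟨s, rfl⟩ := h U s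
  exact ⟨_, stalkRingHom_germ f U x hx s⟩

theorem stalkRingHom_injective {W : X.Opens}
    (h : ∀ U ≤ W, Function.Injective (sectionMap f U)) {x : X} (hx : x ∈ W) :
    Function.Injective (stalkRingHom f x) := by
  rw [injective_iff_map_eq_zero]
  intro t ht
  obtain ⟨U, hU, hx, s, rfl⟩ := 𝒜.exists_le_germ_eq t hx
  rw [stalkRingHom_germ] at ht
  obtain ⟨V, hV, hxV, hs⟩ := ℬ.exists_le_res_eq_zero hx _ ht
  rw [← res_sectionMap] at hs
  rw [← 𝒜.germ_res hV x hxV, h V (hV.trans hU) (hs.trans (map_zero _).symm), map_zero]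

include hf in
theorem sectionMap_smul (U : X.Opens) (a : X.presheaf.obj (op U)) (s : 𝒜.sheaf.obj.obj (op U)) :
    sectionMap f U (a • s) = a • sectionMap f U s := by
  refine (map_mul (sectionMap f U) _ _).trans ?_
  exact congrArg (· * sectionMap f U s) congr($(hf).hom.app (op U) a)

include hf in
theorem stalkRingHom_algebraMap (x : X) (a : X.presheaf.stalk x) :
    stalkRingHom f x (algebraMap _ _ a) = algebraMap _ _ a := by
  obtain ⟨U, hx, a, rfl⟩ := TopCat.Presheaf.exists_germ_eq X.presheaf a
  have h1 := congr($(hf).hom.app (op U) a)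
  refine (congrArg (stalkRingHom f x) (𝒜.stalkHom_germ x U hx a)).trans ?_
  refine Eq.trans ?_ (ℬ.stalkHom_germ x U hx a).symm
  exact (stalkRingHom_germ f U x hx _).trans (congrArg (ℬ.germ U x hx) h1)

/-- The map on stalks of a morphism of algebra sheaves, as an algebra homomorphism. -/
def stalkAlgHom (x : X) : 𝒜.Stalk x →ₐ[X.presheaf.stalk x] ℬ.Stalk x :=
  { stalkRingHom f x with commutes' := stalkRingHom_algebraMap f hf x }

variable {k : Type u} [Field k] [X.Over (Spec (.of k))]

/-- The map on fibres of a morphism of algebra sheaves. -/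
def fibreAlgHom (x : X) : 𝒜.Fibre x →ₐ[k] ℬ.Fibre x :=
  Ideal.Quotient.liftₐ _ ((Ideal.Quotient.mkₐ k (ℬ.fibreIdeal x)).comp
    { stalkRingHom f x with commutes' := fun c => stalkRingHom_algebraMap f hf x _ }) (by
      intro a ha
      refine Ideal.Quotient.eq_zero_iff_mem.mpr ?_
      refine Ideal.mem_comap.mp ((Ideal.map_le_iff_le_comap (K := (ℬ.fibreIdeal x).comap (stalkRingHom f x))).mpr ?_ ha)
      intro r hr
      refine Ideal.mem_comap.mpr (Ideal.mem_comap.mpr ?_)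
      rw [stalkRingHom_algebraMap f hf]
      exact Ideal.mem_map_of_mem _ hr)

theorem fibreAlgHom_mk (x : X) (s : 𝒜.Stalk x) :
    fibreAlgHom (k := k) f hf x (Ideal.Quotient.mk _ s) = Ideal.Quotient.mk _ (stalkRingHom f x s) :=
  rfl

theorem fibreAlgHom_surjective (x : X) (h : Function.Surjective (stalkRingHom f x)) :
    Function.Surjective (fibreAlgHom (k := k) f hf x) := by
  intro t
  obtain ⟨t, rfl⟩ := Ideal.Quotient.mk_surjective t
  obtain ⟨s, rfl⟩ := h t
  exact ⟨Ideal.Quotient.mk _ s, rfl⟩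

theorem fibreAlgHom_bijective (x : X) (h : Function.Bijective (stalkRingHom f x)) :
    Function.Bijective (fibreAlgHom (k := k) f hf x) := by
  refine ⟨?_, fibreAlgHom_surjective f hf x h.2⟩
  rw [injective_iff_map_eq_zero]
  intro t ht
  obtain ⟨t, rfl⟩ := Ideal.Quotient.mk_surjective t
  rw [fibreAlgHom_mk, Ideal.Quotient.eq_zero_iff_mem] at ht
  refine Ideal.Quotient.eq_zero_iff_mem.mpr ?_
  let e := RingEquiv.ofBijective (stalkRingHom f x) h
  have he (s) : e.symm (stalkRingHom f x s) = s := e.symm_apply_apply s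
  have : ℬ.fibreIdeal x ≤ (𝒜.fibreIdeal x).comap (e.symm : ℬ.Stalk x →+* 𝒜.Stalk x) := by
    refine Ideal.map_le_iff_le_comap.mpr fun r hr => ?_
    refine Ideal.mem_comap.mpr (Ideal.mem_comap.mpr ?_)
    rw [← stalkRingHom_algebraMap f hf]
    exact (he _).symm ▸ Ideal.mem_map_of_mem _ hr
  have h2 := Ideal.mem_comap.mp (this ht)
  exact (he t) ▸ h2

end StalkMap

end AlgebraSheaf

end

/-! ### Local rings with principal maximal ideal -/

section

open IsLocalRing

theorem IsRegularLocalRing.exists_maximalIdeal_eq_span_singleton (R : Type*) [CommRing R]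
    [IsRegularLocalRing R] (h : ringKrullDim R = 1) :
    ∃ π : R, maximalIdeal R = Ideal.span {π} := by
  have h1 : (maximalIdeal R).spanFinrank = 1 := by
    have := (IsRegularLocalRing.spanFinrank_maximalIdeal (R := R)).trans h
    exact_mod_cast this
  have h2 := Submodule.FG.generators_ncard (IsNoetherian.noetherian (maximalIdeal R))
  rw [h1, Set.ncard_eq_one] at h2
  obtain ⟨π, hπ⟩ := h2
  exact ⟨π, by rw [← Submodule.span_generators (maximalIdeal R), hπ, Ideal.span]⟩

/-- By Krull's intersection theorem `a` leaves the powers of the maximal ideal at some stage. Take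
the last power containing it. -/
theorem IsLocalRing.exists_eq_unit_mul_pow {R : Type*} [CommRing R] [IsLocalRing R]
    [IsNoetherianRing R] {π : R} (hπ : maximalIdeal R = Ideal.span {π}) {a : R} (ha : a ≠ 0) :
    ∃ (u : R) (n : ℕ), IsUnit u ∧ a = u * π ^ n := by
  have h1 : ∃ n, a ∉ maximalIdeal R ^ n := by
    by_contra! hc
    have h2 : a ∈ ⨅ i, maximalIdeal R ^ i := by simpa using hc
    rw [Ideal.iInf_pow_eq_bot_of_isLocalRing _ (Ideal.IsPrime.ne_top inferInstance)] at h2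
    exact ha h2
  classical
  obtain ⟨n, hn⟩ : ∃ n, Nat.find h1 = n + 1 := Nat.exists_eq_succ_of_ne_zero fun h0 => by
    have := Nat.find_spec h1
    simp [h0] at this
  have h3 : a ∈ maximalIdeal R ^ n := not_not.mp (Nat.find_min h1 (by lia))
  have h4 := Nat.find_spec h1
  rw [hn] at h4
  rw [hπ, Ideal.span_singleton_pow, Ideal.mem_span_singleton'] at h3
  obtain ⟨u, rfl⟩ := h3
  refine ⟨u, n, ?_, rfl⟩
  by_contra hu
  rw [pow_succ'] at h4
  exact h4 (Ideal.mul_mem_mul ((mem_maximalIdeal u).mpr hu)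
    (Ideal.pow_mem_pow (hπ ▸ Ideal.mem_span_singleton_self π) n))

/-- A nilpotent `π` would lie in every prime and force dimension zero, while two nonzero elements
with product zero would, written as unit times power of `π`, make `π` nilpotent. -/
theorem IsLocalRing.isDomain_of_maximalIdeal_eq_span_singleton {R : Type*} [CommRing R]
    [IsLocalRing R] [IsNoetherianRing R] {π : R} (hπ : maximalIdeal R = Ideal.span {π})
    (h : ringKrullDim R ≠ 0) : IsDomain R := by
  have hnil : ¬ IsNilpotent π := by
    intro hn
    refine h ?_
    have : Ring.KrullDimLE 0 R := by
      refine Ring.krullDimLE_zero_iff.mpr fun P hP => ?_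
      have : maximalIdeal R ≤ P := by
        rw [hπ, Ideal.span_singleton_le_iff_mem]
        exact nilpotent_iff_mem_prime.mp hn P hP
      rw [← (maximalIdeal.isMaximal R).eq_of_le hP.ne_top this]
      infer_instance
    exact ringKrullDimZero_iff_ringKrullDim_eq_zero.mp this
  have : NoZeroDivisors R := ⟨fun {a b} hab => by
    by_contra! hc
    obtain ⟨u, n, hu, rfl⟩ := exists_eq_unit_mul_pow hπ hc.1
    obtain ⟨v, m, hv, rfl⟩ := exists_eq_unit_mul_pow hπ hc.2
    refine hnil ⟨n + m, ((hu.mul hv).mul_right_eq_zero).mp ?_⟩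
    rw [← hab]
    ring⟩
  exact NoZeroDivisors.to_isDomain R

theorem IsRegularLocalRing.isDomain_of_ringKrullDim_eq_one (R : Type*) [CommRing R]
    [IsRegularLocalRing R] (h : ringKrullDim R = 1) : IsDomain R := by
  obtain ⟨π, hπ⟩ := exists_maximalIdeal_eq_span_singleton R h
  exact IsLocalRing.isDomain_of_maximalIdeal_eq_span_singleton hπ (by simp [h])

/-- Over a noetherian local domain with principal maximal ideal, a module on which a generator of
the maximal ideal acts injectively is flat. -/
theorem Module.Flat.of_isSMulRegular_uniformizer {R M : Type*} [CommRing R] [IsDomain R]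
    [IsLocalRing R] [IsNoetherianRing R] [AddCommGroup M] [Module R M] {π : R}
    (hπ : maximalIdeal R = Ideal.span {π}) (h : IsSMulRegular M π) : Module.Flat R M := by
  have : IsPrincipalIdealRing R :=
    ((tfae_of_isNoetherianRing_of_isLocalRing_of_isDomain R).out 4 0).mp
      (show (maximalIdeal R).IsPrincipal from ⟨π, hπ⟩)
  have : Module.IsTorsionFree R M := .of_smul_eq_zero fun a m ham => by
    by_contra! hc
    obtain ⟨u, n, hu, rfl⟩ := exists_eq_unit_mul_pow hπ hc.1
    rw [mul_smul] at ham
    exact hc.2 ((h.pow n).right_eq_zero_of_smul (hu.smul_eq_zero.mp ham))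
  infer_instance

end

/-! ### Local equations of closed points, generizations and residue fields -/

namespace AlgebraicGeometry

open IsLocalRing

variable {X : Scheme.{u}}

theorem Scheme.exists_affine_le {x : X} {U : X.Opens} (hx : x ∈ U) :
    ∃ V ≤ U, IsAffineOpen V ∧ x ∈ V := by
  obtain ⟨_, ⟨V, hV, rfl⟩, hxV, hVU⟩ := X.isBasis_affineOpens.exists_subset_of_mem_open hx U.2
  exact ⟨V, hVU, hV, hxV⟩

theorem Scheme.notMem_basicOpen_iff_germ_mem (U : X.Opens) (x : X) (hx : x ∈ U) (a : Γ(X, U)) :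
    x ∉ X.basicOpen a ↔ X.presheaf.germ U x hx a ∈ maximalIdeal (X.presheaf.stalk x) := by
  rw [X.mem_basicOpen a x hx, mem_maximalIdeal, mem_nonunits_iff]

/-- Near a closed point `p` with principal maximal ideal, the generator cuts out `p`. -/
theorem Scheme.exists_basicOpen_eq_inf_puncture [IsLocallyNoetherian X] {p : X}
    (hp : IsClosed {p}) {ϖ : X.presheaf.stalk p}
    (hϖ : maximalIdeal (X.presheaf.stalk p) = Ideal.span {ϖ}) :
    ∃ (U : X.Opens) (hpU : p ∈ U) (a : Γ(X, U)),
      X.presheaf.germ U p hpU a = ϖ ∧ X.basicOpen a = U ⊓ puncture hp := by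
  obtain ⟨U₀, hpU₀, a₀, ha₀⟩ := X.presheaf.exists_germ_eq ϖ
  obtain ⟨U, hUU₀, hU, hpU⟩ := Scheme.exists_affine_le hpU₀
  let a := X.presheaf.map (homOfLE hUU₀).op a₀
  have ha : X.presheaf.germ U p hpU a = ϖ :=
    (X.presheaf.germ_res_apply (homOfLE hUU₀) p hpU a₀).trans ha₀
  have hcomp : IsCompact ((U ⊓ puncture hp : X.Opens) : Set X) := by
    have : IsNoetherianRing Γ(X, U) := IsLocallyNoetherian.component_noetherian ⟨U, hU⟩
    have := noetherianSpace_of_isAffineOpen U hU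
    have h1 := TopologicalSpace.NoetherianSpace.isCompact
      (Subtype.val ⁻¹' ((puncture hp : X.Opens) : Set X) : Set U)
    have h2 := h1.image continuous_subtype_val
    exact (Subtype.image_preimage_coe _ _).subst (motive := IsCompact) h2
  have hg (x : ((U ⊓ puncture hp : X.Opens) : Set X)) : ∃ f : Γ(X, U),
      X.basicOpen f ≤ U ⊓ puncture hp ∧ x.1 ∈ X.basicOpen f :=
    hU.exists_basicOpen_le (V := U ⊓ puncture hp) ⟨x.1, x.2⟩ x.2.1
  choose g hgle hgmem using hg
  obtain ⟨t, ht⟩ := hcomp.elim_finite_subcover (fun x => (X.basicOpen (g x) : Set X))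
    (fun x => (X.basicOpen (g x)).isOpen) (fun x hx => Set.mem_iUnion.mpr ⟨⟨x, hx⟩, hgmem ⟨x, hx⟩⟩)
  -- Each `g x` vanishes at `p`, so near `p` it is a multiple of `a` and `D(g x)` lies in `D(a)`.
  -- Finitely many `D(g x)` cover the punctured `U`, so one neighbourhood of `p` serves them all.
  have hW (x : ((U ⊓ puncture hp : X.Opens) : Set X)) : ∃ W : X.Opens, W ≤ U ∧ p ∈ W ∧
      W ⊓ X.basicOpen (g x) ≤ X.basicOpen a := by
    have h1 : X.presheaf.germ U p hpU (g x) ∈ Ideal.span {ϖ} := by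
      rw [← hϖ, ← Scheme.notMem_basicOpen_iff_germ_mem]
      exact fun h => (hgle x h).2 rfl
    obtain ⟨c, hc⟩ := Ideal.mem_span_singleton'.mp h1
    obtain ⟨V, hVU, hpV, c, rfl⟩ := X.presheaf.exists_le_germ_eq c hpU
    rw [← ha, ← X.presheaf.germ_res_apply (homOfLE hVU) p hpV a, ← map_mul] at hc
    obtain ⟨W, hpW, i, j, e⟩ := X.presheaf.germ_eq p _ _ _ _ hc
    refine ⟨W, j.le, hpW, ?_⟩
    rintro y ⟨hyW, hy⟩
    have h2 : y ∈ X.basicOpen (X.presheaf.map j.op (g x)) := by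
      rw [Scheme.basicOpen_res]; exact ⟨hyW, hy⟩
    rw [← e, map_mul, Scheme.basicOpen_mul, ← CommRingCat.comp_apply, ← Functor.map_comp,
      ← op_comp] at h2
    have := h2.2
    rw [Scheme.basicOpen_res] at this
    exact this.2
  obtain ⟨W, hWU, hpW, hWa⟩ : ∃ W : X.Opens, W ≤ U ∧ p ∈ W ∧
      ∀ x ∈ t, W ⊓ X.basicOpen (g x) ≤ X.basicOpen a := by
    clear ht
    induction t using Finset.cons_induction with
    | empty => exact ⟨U, le_rfl, hpU, by simp⟩
    | cons x t hxt ih =>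
      obtain ⟨W, hWU, hpW, hWa⟩ := ih
      obtain ⟨W', -, hpW', hWa'⟩ := hW x
      refine ⟨W ⊓ W', inf_le_left.trans hWU, ⟨hpW, hpW'⟩, ?_⟩
      intro y hy
      rcases Finset.mem_cons.mp hy with rfl | hy
      · exact (inf_le_inf_right _ inf_le_right).trans hWa'
      · exact (inf_le_inf_right _ inf_le_left).trans (hWa y hy)
  refine ⟨W, hpW, X.presheaf.map (homOfLE hWU).op a,
    (X.presheaf.germ_res_apply _ p hpW a).trans ha, ?_⟩
  rw [Scheme.basicOpen_res]
  apply le_antisymm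
  · rintro y ⟨hyW, hya⟩
    refine ⟨hyW, ?_⟩
    rintro rfl
    have hya := (Scheme.mem_basicOpen _ _ _ hpU).mp hya
    rw [ha] at hya
    exact (mem_maximalIdeal ϖ).mp (hϖ ▸ Ideal.mem_span_singleton_self ϖ) hya
  · rintro y ⟨hyW, hyp⟩
    obtain ⟨x, hxt, hyx⟩ := Set.mem_iUnion₂.mp (ht ⟨hWU hyW, hyp⟩)
    exact ⟨hyW, hWa x hxt ⟨hyW, hyx⟩⟩

/-- On an affine open an empty `D(a)` means that `a` is nilpotent, and a nilpotent germ in a domain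
is zero. -/
theorem Scheme.basicOpen_nonempty_of_germ_ne_zero {x : X} [IsDomain (X.presheaf.stalk x)]
    {U : X.Opens} (hx : x ∈ U) (a : Γ(X, U)) (ha : X.presheaf.germ U x hx a ≠ 0) :
    (X.basicOpen a : Set X).Nonempty := by
  obtain ⟨V, hVU, hV, hxV⟩ := Scheme.exists_affine_le hx
  by_contra hc
  rw [Set.not_nonempty_iff_eq_empty] at hc
  have h1 : X.basicOpen (X.presheaf.map (homOfLE hVU).op a) = ⊥ := by
    rw [Scheme.basicOpen_res, eq_bot_iff]
    rintro y ⟨-, hy⟩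
    exact (hc.le hy).elim
  have h2 := (Scheme.isNilpotent_iff_basicOpen_eq_bot_of_isCompact hV.isCompact _).mpr h1
  have h3 := (h2.map (X.presheaf.germ V x hxV).hom).eq_zero
  exact ha ((X.presheaf.germ_res_apply (homOfLE hVU) x hxV a).symm.trans h3)

/-- A proper generization of a closed point whose local ring is a noetherian domain with principal
maximal ideal has a field as local ring. -/
theorem Scheme.isField_stalk_of_specializes {x y : X} (hy : IsClosed {y}) (hxy : x ⤳ y)
    (hne : x ≠ y) [IsNoetherianRing (X.presheaf.stalk y)] {ϖ : X.presheaf.stalk y}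
    (hϖ : maximalIdeal (X.presheaf.stalk y) = Ideal.span {ϖ}) : IsField (X.presheaf.stalk x) := by
  obtain ⟨U, -, hU, hyU⟩ := Scheme.exists_affine_le (TopologicalSpace.Opens.mem_top y)
  have hxU : x ∈ U := hxy.mem_open U.isOpen hyU
  let φ := (X.presheaf.stalkSpecializes hxy).hom
  have hφ (r : Γ(X, U)) : φ (X.presheaf.germ U y hyU r) = X.presheaf.germ U x hxU r :=
    X.presheaf.germ_stalkSpecializes_apply hyU hxy r
  -- A nonzero `b` is a unit times a power of `ϖ`, so `ϖ`, and with it every function vanishing at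
  -- `y`, would vanish at `x`. The `g` below vanishes at `y` but not at `x`.
  have hlt (b) (hb : b ∈ (maximalIdeal (X.presheaf.stalk x)).comap φ) : b = 0 := by
    by_contra hb0
    obtain ⟨c, n, hc, rfl⟩ := exists_eq_unit_mul_pow hϖ hb0
    have h1 : ϖ ∈ (maximalIdeal (X.presheaf.stalk x)).comap φ := by
      refine Ideal.IsPrime.mem_of_pow_mem inferInstance n ?_
      exact (Ideal.unit_mul_mem_iff_mem _ hc).mp hb
    obtain ⟨g, hgle, hg⟩ := hU.exists_basicOpen_le (V := puncture hy) ⟨x, hne⟩ hxU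
    have h2 : y ∉ X.basicOpen g := fun h => hgle h rfl
    rw [Scheme.notMem_basicOpen_iff_germ_mem _ _ hyU, hϖ, Ideal.mem_span_singleton'] at h2
    obtain ⟨d, hd⟩ := h2
    have h3 := Ideal.mul_mem_left _ d h1
    rw [hd, Ideal.mem_comap, hφ, ← Scheme.notMem_basicOpen_iff_germ_mem] at h3
    exact h3 hg
  rw [isField_iff_maximalIdeal_eq, eq_bot_iff]
  intro b hb
  have := hU.isLocalization_stalk ⟨x, hxU⟩
  -- Germs at `x` are fractions of sections over `U`; the numerators come from the stalk at `y`,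
  -- where `hlt` applies.
  let _ := X.presheaf.algebra_section_stalk ⟨x, hxU⟩
  obtain ⟨⟨r, s⟩, hrs⟩ := IsLocalization.surj (hU.primeIdealOf ⟨x, hxU⟩).asIdeal.primeCompl b
  have hr : X.presheaf.germ U x hxU r ∈ maximalIdeal (X.presheaf.stalk x) := by
    have : X.presheaf.germ U x hxU r = b * X.presheaf.germ U x hxU s := hrs.symm
    rw [this]
    exact Ideal.mul_mem_right _ _ hb
  have h0 : X.presheaf.germ U x hxU r = 0 := by
    rw [← hφ] at hr ⊢
    rw [hlt _ hr, map_zero]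
  have hs : IsUnit (algebraMap Γ(X, U) (X.presheaf.stalk x) s) := IsLocalization.map_units _ s
  exact (hs.mul_left_eq_zero).mp (hrs.trans h0)

section Residue

variable (k : Type u) [Field k] [IsAlgClosed k] [X.Over (Spec (.of k))]
  [LocallyOfFiniteType (X ↘ Spec (.of k))]

/-- The Nullstellensatz: the residue field at a closed point is `k`. The work lies in checking that
the identification is the one induced by `baseToStalk`. -/
theorem exists_sub_baseToStalk_mem {x : X} (hx : IsClosed {x}) (a : X.presheaf.stalk x) :
    ∃ c : k, a - baseToStalk k X x c ∈ maximalIdeal (X.presheaf.stalk x) := by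
  have h : (residueFieldIsoBase (X ↘ Spec (.of k)) x hx).inv =
      CommRingCat.ofHom (baseToStalk k X x) ≫ X.residue x := by
    apply Spec.map_injective
    rw [SpecMap_residueFieldIsoBase_inv, baseToStalk]
    have h1 : X ↘ Spec (.of k) = X.toSpecΓ ≫ Spec.map ((X ↘ Spec (.of k)).appTop) ≫
        Spec.map (Scheme.ΓSpecIso (.of k)).inv := by
      rw [← Scheme.toSpecΓ_naturality_assoc, toSpecΓ_SpecMap_ΓSpecIso_inv, Category.comp_id]
    conv_lhs => rw [h1]
    rw [Scheme.fromSpecResidueField, Category.assoc, Scheme.fromSpecStalk_toSpecΓ_assoc]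
    simp only [CommRingCat.ofHom_hom, Spec.map_comp, Category.assoc]
  refine ⟨(residueFieldIsoBase (X ↘ Spec (.of k)) x hx).hom (X.residue x a), ?_⟩
  rw [← IsLocalRing.residue_eq_zero_iff, map_sub, sub_eq_zero]
  have h2 := congr($h ((residueFieldIsoBase (X ↘ Spec (.of k)) x hx).hom (X.residue x a)))
  rw [Iso.hom_inv_id_apply] at h2
  exact h2

end Residue

end AlgebraicGeometry

/-! ### Quasi-coherence as localization of sections on affine opens -/

namespace AlgebraicGeometry.Scheme.Modules

variable {X : Scheme.{u}}

/-- The sections of a module over an open `U` behave as those of a quasi-coherent module over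
an affine open: those over `D(f)` are fractions of those over `U`. -/
structure IsLocalizingOn (M : X.Modules) (U : X.Opens) : Prop where
  exists_extension (f : Γ(X, U)) (s : Γ(M, X.basicOpen f)) : ∃ (n : ℕ) (t : Γ(M, U)),
    M.presheaf.map (homOfLE (X.basicOpen_le f)).op t =
      X.presheaf.map (homOfLE (X.basicOpen_le f)).op f ^ n • s
  exists_pow_smul_eq_zero (f : Γ(X, U)) (t : Γ(M, U))
    (ht : M.presheaf.map (homOfLE (X.basicOpen_le f)).op t = 0) : ∃ n : ℕ, f ^ n • t = 0

section

variable {U : X.Opens} (hU : IsAffineOpen U)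

theorem fromSpec_image_le (V : (Spec Γ(X, U)).Opens) : hU.fromSpec ''ᵁ V ≤ U :=
  (hU.fromSpec.image_le_opensRange V).trans hU.opensRange_fromSpec.le

/-- `Γ(X, U)` acts on sections over `Spec Γ(X, U)` through global functions there; this identity
turns that action into restriction of functions on `X`. -/
theorem fromSpec_appIso_inv (V : (Spec Γ(X, U)).Opens) :
    (ΓSpecIso Γ(X, U)).inv ≫ (Spec Γ(X, U)).presheaf.map V.leTop.op ≫
      (hU.fromSpec.appIso V).inv = X.presheaf.map (homOfLE (fromSpec_image_le hU V)).op := by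
  rw [← Category.assoc, Iso.comp_inv_eq, Scheme.Hom.appIso_hom', Scheme.Hom.map_appLE]
  rw [Scheme.Hom.appLE, hU.fromSpec_app_self]
  simp only [Category.assoc, ← Functor.map_comp]
  rfl

theorem restrictAppIso_smul_fromSpec (M : X.Modules) (V : (Spec Γ(X, U)).Opens) (r : Γ(X, U))
    (x : Γ(M.restrict hU.fromSpec, V)) :
    (M.restrictAppIso hU.fromSpec V).hom (r • x) =
      X.presheaf.map (homOfLE (fromSpec_image_le hU V)).op r •
        (M.restrictAppIso hU.fromSpec V).hom x := by
  rw [smul_Spec_def, smul_restrictAppIso_hom_apply, ← fromSpec_appIso_inv hU V]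
  rfl

/-- Sections of the restriction of `M` to `Spec Γ(X, U)` are sections of `M` over the image. -/
noncomputable def restrictFromSpecEquiv (M : X.Modules) (V : (Spec Γ(X, U)).Opens) (W : X.Opens)
    (h : hU.fromSpec ''ᵁ V = W) : Γ(M.restrict hU.fromSpec, V) ≃+ Γ(M, W) :=
  ((M.restrictAppIso hU.fromSpec V) ≪≫
    M.presheaf.mapIso (eqToIso h.symm).op).addCommGroupIsoToAddEquiv

theorem restrictFromSpecEquiv_smul (M : X.Modules) (V : (Spec Γ(X, U)).Opens) (W : X.Opens)
    (h : hU.fromSpec ''ᵁ V = W) (hW : W ≤ U) (r : Γ(X, U)) (x : Γ(M.restrict hU.fromSpec, V)) :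
    restrictFromSpecEquiv hU M V W h (r • x) =
      X.presheaf.map (homOfLE hW).op r • restrictFromSpecEquiv hU M V W h x := by
  subst h
  have h1 (y) : restrictFromSpecEquiv hU M V _ rfl y = (M.restrictAppIso hU.fromSpec V).hom y :=
    congr($(M.presheaf.map_id _) _)
  rw [h1, h1, restrictAppIso_smul_fromSpec]

theorem restrictFromSpecEquiv_map (M : X.Modules) {V V' : (Spec Γ(X, U)).Opens} {W W' : X.Opens}
    (h : hU.fromSpec ''ᵁ V = W) (h' : hU.fromSpec ''ᵁ V' = W') (i : V' ≤ V) (hW : W' ≤ W)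
    (x : Γ(M.restrict hU.fromSpec, V)) :
    restrictFromSpecEquiv hU M V' W' h' ((M.restrict hU.fromSpec).presheaf.map (homOfLE i).op x) =
      M.presheaf.map (homOfLE hW).op (restrictFromSpecEquiv hU M V W h x) := by
  subst h h'
  have h1 (V) (y) : restrictFromSpecEquiv hU M V _ rfl y = (M.restrictAppIso hU.fromSpec V).hom y :=
    congr($(M.presheaf.map_id _) _)
  rw [h1, h1]
  rfl

theorem fromSpec_image_top : hU.fromSpec ''ᵁ ⊤ = U := by
  rw [Scheme.Hom.image_top_eq_opensRange, hU.opensRange_fromSpec]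

/-- Global sections of the restriction of `M` to `Spec Γ(X, U)` are sections of `M` over `U`. -/
noncomputable def topRestrictFromSpecEquiv (M : X.Modules) :
    Γ(M.restrict hU.fromSpec, ⊤) ≃+ Γ(M, U) :=
  restrictFromSpecEquiv hU M ⊤ U (fromSpec_image_top hU)

/-- Sections over `D(f)` of the restriction of `M` to `Spec Γ(X, U)` are sections of `M` over
the basic open of `f`. -/
noncomputable def basicOpenRestrictFromSpecEquiv (M : X.Modules) (f : Γ(X, U)) :
    Γ(M.restrict hU.fromSpec, (PrimeSpectrum.basicOpen f : (Spec Γ(X, U)).Opens)) ≃+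
      Γ(M, X.basicOpen f) :=
  restrictFromSpecEquiv hU M (PrimeSpectrum.basicOpen f) (X.basicOpen f)
    (hU.fromSpec_image_basicOpen f)

theorem topRestrictFromSpecEquiv_smul (M : X.Modules) (r : Γ(X, U))
    (x : Γ(M.restrict hU.fromSpec, ⊤)) :
    topRestrictFromSpecEquiv hU M (r • x) = r • topRestrictFromSpecEquiv hU M x := by
  refine (restrictFromSpecEquiv_smul hU M _ _ _ le_rfl r x).trans ?_
  exact congrArg (· • topRestrictFromSpecEquiv hU M x) congr($(X.presheaf.map_id _) r)

theorem basicOpenRestrictFromSpecEquiv_smul (M : X.Modules) (f r : Γ(X, U))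
    (V : (Spec Γ(X, U)).Opens) (hV : V = PrimeSpectrum.basicOpen f)
    (x : Γ(M.restrict hU.fromSpec, V)) :
    restrictFromSpecEquiv hU M V (X.basicOpen f) (hV ▸ hU.fromSpec_image_basicOpen f) (r • x) =
      X.presheaf.map (homOfLE (X.basicOpen_le f)).op r •
        restrictFromSpecEquiv hU M V (X.basicOpen f) (hV ▸ hU.fromSpec_image_basicOpen f) x :=
  restrictFromSpecEquiv_smul hU M _ _ _ _ r x

theorem basicOpenRestrictFromSpecEquiv_map (M : X.Modules) (f : Γ(X, U))
    (x : Γ(M.restrict hU.fromSpec, ⊤)) :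
    basicOpenRestrictFromSpecEquiv hU M f
      ((M.restrict hU.fromSpec).presheaf.map (homOfLE le_top).op x) =
      M.presheaf.map (homOfLE (X.basicOpen_le f)).op (topRestrictFromSpecEquiv hU M x) :=
  restrictFromSpecEquiv_map hU M _ _ _ _ x

theorem isLocalizingOn_of_isLocalizing (M : X.Modules)
    (h : IsLocalizing (modulesSpecToSheaf.obj (M.restrict hU.fromSpec))) :
    M.IsLocalizingOn U := by
  let e := topRestrictFromSpecEquiv hU M
  let e' := basicOpenRestrictFromSpecEquiv hU M
  have he := topRestrictFromSpecEquiv_smul hU M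
  have he' (f r) := basicOpenRestrictFromSpecEquiv_smul hU M f r _ rfl
  have hmap := basicOpenRestrictFromSpecEquiv_map hU M
  constructor
  · intro f s
    obtain ⟨⟨t, _, n, rfl⟩, ht⟩ := (h f).surj ((e' f).symm s)
    refine ⟨n, e t, ?_⟩
    refine (hmap f t).symm.trans (congr(e' f $ht).symm.trans ((he' f (f ^ n) _).trans ?_))
    rw [map_pow]
    exact congrArg _ ((e' f).apply_symm_apply s)
  · intro f t ht
    obtain ⟨t, rfl⟩ := e.surjective t
    rw [← hmap, EmbeddingLike.map_eq_zero_iff] at ht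
    obtain ⟨⟨_, n, rfl⟩, hn⟩ := (h f).exists_of_eq (ht.trans (map_zero _).symm)
    exact ⟨n, by rw [← he]; exact congr(e $hn).trans ((congrArg e (smul_zero _)).trans (map_zero e))⟩

theorem IsLocalizingOn.isLocalizing {M : X.Modules} (h : M.IsLocalizingOn U) :
    IsLocalizing (modulesSpecToSheaf.obj (M.restrict hU.fromSpec)) := by
  let e := topRestrictFromSpecEquiv hU M
  let e' := basicOpenRestrictFromSpecEquiv hU M
  have he := topRestrictFromSpecEquiv_smul hU M
  have he' (f r) := basicOpenRestrictFromSpecEquiv_smul hU M f r _ rfl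
  have hmap := basicOpenRestrictFromSpecEquiv_map hU M
  intro f
  refine IsLocalizedModule.Away.mk_of_addCommGroup ?_ ?_ ?_
  · exact isUnit_algebraMap_end_of_le_basicOpen f le_rfl
  · intro x
    obtain ⟨n, t, ht⟩ := h.exists_extension f (e' f x)
    refine ⟨n, e.symm t, (e' f).injective ?_⟩
    refine (he' f (f ^ n) x).trans ?_
    refine Eq.trans ?_ (hmap f (e.symm t)).symm
    rw [AddEquiv.apply_symm_apply, ht, map_pow]
    rfl
  · intro x hx
    obtain ⟨n, hn⟩ := h.exists_pow_smul_eq_zero f (e x)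
      ((hmap f x).symm.trans (congr(e' f $hx).trans (map_zero _)))
    exact ⟨n, e.injective ((he _ _).trans (hn.trans (map_zero e).symm))⟩

end

instance isQuasicoherent_restrict_fromSpec {U : X.Opens} (hU : IsAffineOpen U) (M : X.Modules)
    [M.IsQuasicoherent] : (M.restrict hU.fromSpec).IsQuasicoherent :=
  isQuasicoherent_restrictFunctor hU.fromSpec M

theorem isLocalizingOn_of_isQuasicoherent (M : X.Modules) [M.IsQuasicoherent] {U : X.Opens}
    (hU : IsAffineOpen U) : M.IsLocalizingOn U :=
  isLocalizingOn_of_isLocalizing hU M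
    ((isIso_fromTildeΓ_iff_isLocalizing _).mp inferInstance)

end AlgebraicGeometry.Scheme.Modules

/-! ### Finite generation on affine opens, and the converse criterion for quasi-coherence -/

namespace AlgebraicGeometry.Scheme.Modules

variable {X : Scheme.{u}}

/-- Since `N` is the tilde of its global sections and tilde is fully faithful, the epimorphism from
a finite free sheaf comes from a module map. Faithful functors reflect epimorphisms, so that map is
surjective. -/
theorem finite_of_generatingSections {R : CommRingCat.{u}} (N : (Spec R).Modules)
    [N.IsQuasicoherent] (σ : SheafOfModules.GeneratingSections N) [σ.IsFiniteType] :
    Module.Finite R Γ(N, ⊤) := by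
  let P : ModuleCat R := (modulesSpecToSheaf.obj N).presheaf.obj (.op ⊤)
  let φ : (tilde.functor R).obj (ModuleCat.of R (σ.I →₀ R)) ⟶ (tilde.functor R).obj P :=
    (tildeFinsupp σ.I).hom ≫ σ.π ≫
      @inv _ _ _ _ N.fromTildeΓ (isIso_fromTildeΓ_of_isQuasicoherent N)
  have hσ : Epi σ.π := σ.epi
  have : Epi φ := epi_comp' (@IsIso.epi_of_iso _ _ _ _ _ (tildeFinsupp σ.I).isIso_hom)
    (epi_comp' hσ (@IsIso.epi_of_iso _ _ _ _ _
      (@IsIso.inv_isIso _ _ _ _ N.fromTildeΓ (isIso_fromTildeΓ_of_isQuasicoherent N))))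
  let ψ := (tilde.functor R).preimage φ
  have : Epi ((tilde.functor R).map ψ) := by rwa [Functor.map_preimage]
  have : Epi ψ := (tilde.functor R).epi_of_epi_map this
  have hψ := (ModuleCat.epi_iff_surjective ψ).mp this
  have : Finite σ.I := SheafOfModules.GeneratingSections.IsFiniteType.finite
  have : Module.Finite R (ModuleCat.of R (σ.I →₀ R)) := inferInstanceAs (Module.Finite R (σ.I →₀ R))
  exact Module.Finite.of_surjective ψ.hom hψ

theorem exists_isAffineOpen_finite (M : X.Modules) [M.IsQuasicoherent]
    [h : SheafOfModules.IsFiniteType.{u} M] {x : X} {W : X.Opens} (hx : x ∈ W) :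
    ∃ U ≤ W, IsAffineOpen U ∧ x ∈ U ∧ Module.Finite Γ(X, U) Γ(M, U) := by
  obtain ⟨σ, hσ⟩ := h.exists_localGeneratorsData
  have cov := σ.coversTop
  rw [Opens.coversTop_iff] at cov
  obtain ⟨i, hi⟩ := TopologicalSpace.Opens.mem_iSup.mp (cov.ge (TopologicalSpace.Opens.mem_top x))
  obtain ⟨U, hUW, hU, hxU⟩ := Scheme.exists_affine_le (U := W ⊓ σ.X i) ⟨hx, hi⟩
  refine ⟨U, hUW.trans inf_le_left, hU, hxU, ?_⟩
  let u := hU.isoSpec.inv ≫ X.homOfLE (U := U) (V := σ.X i) (hUW.trans inf_le_right)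
  have hu : Limits.PreservesColimitsOfSize.{u, u} (restrictFunctor u) := inferInstance
  have he : Limits.PreservesColimitsOfSize.{u, u} (overEquiv (σ.X i)).functor := inferInstance
  let F := (overEquiv (σ.X i)).functor ⋙ restrictFunctor u
  let iso : SheafOfModules.overFunctor X.ringCatSheaf _ ⋙ F ≅ restrictFunctor hU.fromSpec :=
    (Functor.associator _ _ _).symm ≪≫
      Functor.isoWhiskerRight (Scheme.Modules.overFunctorEquiv _) _ ≪≫
      (restrictFunctorComp _ _).symm ≪≫ (restrictFunctorCongr (by simp [u]))
  have : (σ.generators i).IsFiniteType := hσ.isFiniteType i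
  let τ₀ := @SheafOfModules.GeneratingSections.map _ _ _ _ _ _ _ _ _ _ _ _ _ (σ.generators i) F
    (@Limits.comp_preservesColimits _ _ _ _ _ _ _ _ he hu) (Scheme.Modules.restrictUnitIso _).symm
  let τ := @SheafOfModules.GeneratingSections.ofEpi _ _ _ _ _ _ _ _ τ₀ (iso.app M).hom
    (@IsIso.epi_of_iso _ _ _ _ _ (iso.app M).isIso_hom)
  have : τ.IsFiniteType := ⟨this.finite⟩
  have hfin := finite_of_generatingSections (M.restrict hU.fromSpec) τ
  exact Module.Finite.equiv (M := Γ(M.restrict hU.fromSpec, ⊤))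
    { topRestrictFromSpecEquiv hU M with
      map_smul' := topRestrictFromSpecEquiv_smul hU M }

/-- Localization makes the restriction to each `Spec Γ(X, U)` a tilde, which has a presentation; the
presentation is then transported to the slice over `U`. -/
theorem isQuasicoherent_of_isLocalizingOn (M : X.Modules)
    (h : ∀ x : X, ∃ U : X.Opens, IsAffineOpen U ∧ x ∈ U ∧ M.IsLocalizingOn U) :
    M.IsQuasicoherent := by
  choose U hU hxU hM using h
  have cov : (Opens.grothendieckTopology X).CoversTop U := by
    rw [Opens.coversTop_iff]
    exact eq_top_iff.mpr fun x _ => TopologicalSpace.Opens.mem_iSup.mpr ⟨x, hxU x⟩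
  refine SheafOfModules.QuasicoherentData.isQuasicoherent.{u, u}
    { I := X, X := U, coversTop := cov, presentation := fun x => ?_ }
  have : IsIso (M.restrict (hU x).fromSpec).fromTildeΓ :=
    (isIso_fromTildeΓ_iff_isLocalizing _).mpr ((hM x).isLocalizing (hU x))
  let P := (tilde (moduleSpecΓFunctor.obj (M.restrict (hU x).fromSpec)))
  let pres : SheafOfModules.Presentation P :=
    presentationTilde.{u} _ .univ (by simp) _ (Submodule.span_eq _)
  let pres₁ : SheafOfModules.Presentation (M.restrict (hU x).fromSpec) :=
    @SheafOfModules.Presentation.ofIsIso.{u, u, u} _ _ _ _ _ _ _ _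
      (M.restrict (hU x).fromSpec).fromTildeΓ this pres
  let iso : restrictFunctor (hU x).fromSpec ⋙ restrictFunctor (hU x).isoSpec.hom ≅
      SheafOfModules.overFunctor X.ringCatSheaf (U x) ⋙ (overEquiv (U x)).functor :=
    (restrictFunctorComp _ _).symm ≪≫ restrictFunctorCongr (by simp) ≪≫
      (Scheme.Modules.overFunctorEquiv _).symm
  let pres₂ := @SheafOfModules.Presentation.ofIsIso.{u, u, u} _ _ _ _ _ _ _ _ (iso.app M).hom
    (iso.app M).isIso_hom (presentationRestrict (hU x).isoSpec.hom pres₁)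
  let F := (overEquiv (U x)).inverse
  let η : SheafOfModules.unit (X.ringCatSheaf.over (U x)) ≅ F.obj (SheafOfModules.unit _) :=
    (overEquiv (U x)).unitIso.app _
  let pres₃ := @SheafOfModules.Presentation.map _ _ _ _ _ _ _ _ _ _ _ _ _ pres₂ F
    (inferInstanceAs (Limits.PreservesColimitsOfSize.{u, u} (overEquiv (U x)).inverse)) η
  exact @SheafOfModules.Presentation.ofIsIso _ _ _ _ _ _ _ _ ((overEquiv (U x)).unitIso.app _).inv
    ((overEquiv (U x)).unitIso.app _).isIso_inv pres₃

end AlgebraicGeometry.Scheme.Modules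

/-! ### Coherence of the quotient and regularity of the uniformizer -/

noncomputable section

theorem AlgebraicGeometry.Scheme.isUnit_res_of_le_basicOpen (X : Scheme.{u}) {U V : X.Opens}
    (a : Γ(X, U)) (h : V ≤ U) (hV : V ≤ X.basicOpen a) :
    IsUnit (X.presheaf.map (homOfLE h).op a) := by
  have h3 : IsUnit (X.presheaf.map (homOfLE hV).op
      (X.presheaf.map (homOfLE (X.basicOpen_le a)).op a)) :=
    (RingedSpace.isUnit_res_basicOpen X.toRingedSpace a).map _
  rwa [← CommRingCat.comp_apply, ← Functor.map_comp] at h3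

namespace AlgebraSheaf

variable {X : Scheme.{u}}

section Modules

variable {𝒜 ℬ : AlgebraSheaf X} (f : 𝒜.sheaf ⟶ ℬ.sheaf) (hf : 𝒜.structureHom ≫ f = ℬ.structureHom)

/-- The morphism of modules underlying a morphism of algebra sheaves. -/
def toModulesHom : SheafOfModules.Hom 𝒜.toModules ℬ.toModules where
  val :=
    { app U := ModuleCat.ofHom
        (X := 𝒜.toModules.val.obj U) (Y := ℬ.toModules.val.obj U)
        { toFun := sectionMap f U.unop
          map_add' := map_add (sectionMap f U.unop)
          map_smul' := sectionMap_smul f hf U.unop }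
      naturality {U V} i := by
        ext s
        exact res_sectionMap f i.unop.le s }

include hf in
theorem isFiniteType_of_surjective (hsurj : ∀ U, Function.Surjective (sectionMap f U))
    [h : SheafOfModules.IsFiniteType.{u} 𝒜.toModules] :
    SheafOfModules.IsFiniteType.{u} ℬ.toModules := by
  obtain ⟨σ, hσ⟩ := h.exists_localGeneratorsData
  let φ : (show SheafOfModules X.ringCatSheaf from 𝒜.toModules) ⟶ ℬ.toModules := toModulesHom f hf
  have hepi (U : X.Opens) : Epi ((SheafOfModules.overFunctor X.ringCatSheaf U).map φ) := by
    constructor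
    intro Z g g' h
    ext V s
    obtain ⟨s, rfl⟩ := hsurj _ s
    exact congr(($h).val.app V s)
  let τ : SheafOfModules.LocalGeneratorsData.{u} (show SheafOfModules X.ringCatSheaf from ℬ.toModules) :=
    { I := σ.I, X := σ.X, coversTop := σ.coversTop, generators := fun i =>
      (σ.generators i).ofEpi ((SheafOfModules.overFunctor X.ringCatSheaf (σ.X i)).map φ) }
  have hτ : τ.IsFiniteType := by
    constructor
    intro i
    have := hσ.isFiniteType i
    exact inferInstanceAs (SheafOfModules.GeneratingSections.IsFiniteType
      ((σ.generators i).ofEpi ((SheafOfModules.overFunctor X.ringCatSheaf (σ.X i)).map φ)))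
  exact SheafOfModules.IsFiniteType.mk.{u}
    (M := (show SheafOfModules X.ringCatSheaf from ℬ.toModules)) ⟨τ, hτ⟩

end Modules

variable (𝒜 : AlgebraSheaf X)

theorem isLocalizingOn_iff (U : X.Opens) : 𝒜.toModules.IsLocalizingOn U ↔
    (∀ (f : Γ(X, U)) (s : 𝒜.sheaf.obj.obj (op (X.basicOpen f))),
      ∃ (n : ℕ) (t : 𝒜.sheaf.obj.obj (op U)), 𝒜.res (X.basicOpen_le f) t =
        X.presheaf.map (homOfLE (X.basicOpen_le f)).op f ^ n • s) ∧
    (∀ (f : Γ(X, U)) (t : 𝒜.sheaf.obj.obj (op U)), 𝒜.res (X.basicOpen_le f) t = 0 →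
      ∃ n : ℕ, f ^ n • t = 0) :=
  ⟨fun h => ⟨h.1, h.2⟩, fun h => ⟨h.1, h.2⟩⟩

open Scheme (puncture)

variable {p : X} (hp : IsClosed {p})

/-- Extension of sections descends along the quotient map. For torsion, a lift `t` vanishes on `D(r)
\ {p} = D(ra)`, so `(ra)^n t = 0`; as `a` is invertible off `p`, `r^n t` vanishes there, hence is
zero in the quotient. -/
theorem punctureImage_isLocalizingOn {U : X.Opens} (h : 𝒜.toModules.IsLocalizingOn U)
    (a : Γ(X, U)) (ha : X.basicOpen a = U ⊓ puncture hp) :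
    (𝒜.punctureImage hp).toModules.IsLocalizingOn U := by
  rw [isLocalizingOn_iff] at h ⊢
  let f := 𝒜.toPunctureImage hp
  have hf : 𝒜.structureHom ≫ f = _ := 𝒜.structureHom_toPunctureImage hp
  refine ⟨fun r s => ?_, fun r t ht => ?_⟩
  · obtain ⟨s, rfl⟩ := 𝒜.toPunctureImage_surjective hp _ s
    obtain ⟨n, t, ht⟩ := h.1 r s
    refine ⟨n, sectionMap f U t, ?_⟩
    rw [← res_sectionMap, ht]
    exact sectionMap_smul f hf _ _ _
  · obtain ⟨t, rfl⟩ := 𝒜.toPunctureImage_surjective hp _ t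
    have h0 : sectionMap f _ (𝒜.res (X.basicOpen_le r) t) = 0 := (res_sectionMap f _ t).trans ht
    have h1 := (𝒜.toPunctureImage_eq_zero_iff hp _ _).mp h0
    rw [res_res] at h1
    obtain ⟨n, hn⟩ := h.2 (r * a) t (by
      have hle : X.basicOpen (r * a) ≤ X.basicOpen r ⊓ puncture hp := by
        rw [Scheme.basicOpen_mul, ha]
        exact inf_le_inf_left _ inf_le_right
      simpa using congr(𝒜.res hle $h1))
    refine ⟨n, ?_⟩
    refine (sectionMap_smul f hf U _ _).symm.trans ?_
    refine (𝒜.toPunctureImage_eq_zero_iff hp _ _).mpr ?_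
    have h2 : 𝒜.res (ha ▸ X.basicOpen_le a : U ⊓ puncture hp ≤ U) (a ^ n • r ^ n • t) = 0 := by
      rw [← mul_smul, ← mul_pow, mul_comm a r, hn, map_zero]
    rw [res_smul, map_pow] at h2
    have hu := X.isUnit_res_of_le_basicOpen a (ha ▸ X.basicOpen_le a) ha.ge
    exact ((hu.pow n).smul_eq_zero).mp h2

end AlgebraSheaf

end

namespace AlgebraSheaf

open Scheme (puncture)
open IsLocalRing

variable {X : Scheme.{u}} (𝒜 : AlgebraSheaf X) {p : X} (hp : IsClosed {p})

theorem punctureImage_isCoherent [IsLocallyNoetherian X] [h : 𝒜.IsCoherent]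
    {ϖ : X.presheaf.stalk p} (hϖ : maximalIdeal (X.presheaf.stalk p) = Ideal.span {ϖ}) :
    (𝒜.punctureImage hp).IsCoherent where
  isQuasicoherent := by
    have := h.isQuasicoherent
    refine Scheme.Modules.isQuasicoherent_of_isLocalizingOn _ fun x => ?_
    obtain ⟨W, hxW, a, ha⟩ : ∃ (W : X.Opens) (_ : x ∈ W) (a : Γ(X, W)),
        X.basicOpen a = W ⊓ puncture hp := by
      by_cases hx : x = p
      · subst hx
        obtain ⟨W, hW, a, -, ha⟩ := Scheme.exists_basicOpen_eq_inf_puncture hp hϖ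
        exact ⟨W, hW, a, ha⟩
      -- Away from `p` there is nothing to remove, and the unit function serves as equation.
      · refine ⟨puncture hp, hx, 1, ?_⟩
        rw [X.basicOpen_of_isUnit isUnit_one, inf_idem]
    obtain ⟨U, hUW, hU, hxU⟩ := Scheme.exists_affine_le hxW
    refine ⟨U, hU, hxU, 𝒜.punctureImage_isLocalizingOn hp
      (Scheme.Modules.isLocalizingOn_of_isQuasicoherent _ hU)
      (X.presheaf.map (homOfLE hUW).op a) ?_⟩
    rw [Scheme.basicOpen_res, ha, ← inf_assoc, inf_eq_left.mpr hUW]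
  isFiniteType := by
    have := h.isFiniteType
    exact isFiniteType_of_surjective (𝒜.toPunctureImage hp) (𝒜.structureHom_toPunctureImage hp)
      (𝒜.toPunctureImage_surjective hp)

/-- If the equation `a` of `p` kills the class of `s`, then `a s` vanishes off `p`, where `a` is
invertible. So `s` itself vanishes off `p` and its class is zero. -/
theorem isSMulRegular_stalk_punctureImage [IsLocallyNoetherian X] {ϖ : X.presheaf.stalk p}
    (hϖ : maximalIdeal (X.presheaf.stalk p) = Ideal.span {ϖ}) :
    IsSMulRegular ((𝒜.punctureImage hp).Stalk p) ϖ := by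
  refine (isSMulRegular_iff_right_eq_zero_of_smul).mpr fun t ht => ?_
  obtain ⟨W, hW, a, rfl, ha⟩ := Scheme.exists_basicOpen_eq_inf_puncture hp hϖ
  obtain ⟨U, hU, hpU, s, rfl⟩ := (𝒜.punctureImage hp).exists_le_germ_eq t hW
  obtain ⟨s, rfl⟩ := 𝒜.toPunctureImage_surjective hp U s
  rw [← X.presheaf.germ_res_apply (homOfLE hU) p hpU a, ← germ_smul] at ht
  obtain ⟨V, hV, hpV, h⟩ := exists_le_res_eq_zero _ _ _ ht
  let f := 𝒜.toPunctureImage hp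
  have h1 : 𝒜.res (inf_le_left : V ⊓ puncture hp ≤ V)
      (𝒜.res hV (X.presheaf.map (homOfLE hU).op a • s)) = 0 :=
    (𝒜.toPunctureImage_eq_zero_iff hp V _).mp <| (res_sectionMap f hV _).trans <|
      (congrArg _ (sectionMap_smul f rfl U _ s)).trans h
  rw [res_res, res_smul, ← CommRingCat.comp_apply, ← Functor.map_comp] at h1
  have hu := X.isUnit_res_of_le_basicOpen a (inf_le_left.trans (hV.trans hU))
    ((inf_le_inf_right (puncture hp) (hV.trans hU)).trans ha.ge)
  replace h1 := hu.smul_eq_zero.mp h1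
  rw [← 𝒜.res_res hV inf_le_left] at h1
  replace h1 := (𝒜.toPunctureImage_eq_zero_iff hp V _).mpr h1
  rw [← germ_res _ hV p hpV]
  exact (congrArg _ ((res_sectionMap f hV s).symm.trans h1)).trans (map_zero _)

theorem stalkRingHom_toPunctureImage_bijective {x : X} (hx : x ≠ p) :
    Function.Bijective (stalkRingHom (𝒜.toPunctureImage hp) x) :=
  ⟨stalkRingHom_injective (𝒜.toPunctureImage hp) (W := puncture hp)
    (fun U hU => 𝒜.toPunctureImage_injective hp U fun h => hU h rfl) hx,
    stalkRingHom_surjective _ (𝒜.toPunctureImage_surjective hp) x⟩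

end AlgebraSheaf

/-! ### Generators of stalks and of fibres -/

namespace AlgebraSheaf

open IsLocalRing

variable {X : Scheme.{u}} (𝒜 : AlgebraSheaf X)

section Fibre

variable {x : X}

theorem mk_smul_eq_zero {a : X.presheaf.stalk x} (ha : a ∈ maximalIdeal (X.presheaf.stalk x))
    (s : 𝒜.Stalk x) : Ideal.Quotient.mk (𝒜.fibreIdeal x) (a • s) = 0 := by
  rw [Algebra.smul_def]
  exact Ideal.Quotient.eq_zero_iff_mem.mpr
    (Ideal.mul_mem_right _ _ (Ideal.mem_map_of_mem _ ha))

theorem mem_maximalIdeal_smul_top {s : 𝒜.Stalk x} (hs : s ∈ 𝒜.fibreIdeal x) :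
    s ∈ maximalIdeal (X.presheaf.stalk x) • (⊤ : Submodule (X.presheaf.stalk x) (𝒜.Stalk x)) := by
  refine Submodule.span_induction ?_ (zero_mem _) (fun _ _ _ _ => add_mem) ?_ hs
  · rintro _ ⟨a, ha, rfl⟩
    rw [Algebra.algebraMap_eq_smul_one]
    exact Submodule.smul_mem_smul ha trivial
  · intro c y _ hy
    refine Submodule.smul_induction_on hy (fun a ha t _ => ?_) fun y z hy hz => ?_
    · rw [smul_eq_mul, mul_smul_comm]
      exact Submodule.smul_mem_smul ha trivial
    · rw [smul_add]
      exact add_mem hy hz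

variable (k : Type u) [Field k] [X.Over (Spec (.of k))]

theorem mk_baseToStalk_smul (c : k) (s : 𝒜.Stalk x) :
    Ideal.Quotient.mk (𝒜.fibreIdeal x) (baseToStalk k X x c • s) =
      c • Ideal.Quotient.mk (𝒜.fibreIdeal x) s := rfl

/-- Nakayama, applied to lifts of a `k`-basis of the fibre. -/
theorem exists_span_stalk_eq_top [Module.Finite (X.presheaf.stalk x) (𝒜.Stalk x)]
    [Module.Finite k (𝒜.Fibre x)] : ∃ t : Fin (Module.finrank k (𝒜.Fibre x)) → 𝒜.Stalk x,
      Submodule.span (X.presheaf.stalk x) (Set.range t) = ⊤ := by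
  let b := Module.finBasis k (𝒜.Fibre x)
  choose t ht using fun i => Ideal.Quotient.mk_surjective (b i)
  refine ⟨t, top_le_iff.mp ?_⟩
  refine Submodule.le_of_le_smul_of_le_jacobson_bot (I := maximalIdeal (X.presheaf.stalk x))
    Module.Finite.fg_top (maximalIdeal_le_jacobson _) fun s _ => ?_
  have h : s - ∑ i, baseToStalk k X x (b.repr (Ideal.Quotient.mk _ s) i) • t i ∈
      𝒜.fibreIdeal x := by
    rw [← Ideal.Quotient.eq_zero_iff_mem, map_sub, map_sum, sub_eq_zero]
    simp_rw [mk_baseToStalk_smul, ht]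
    exact (b.sum_repr _).symm
  refine Submodule.mem_sup.mpr ⟨_, ?_, _, 𝒜.mem_maximalIdeal_smul_top h, add_sub_cancel _ _⟩
  exact Submodule.sum_mem _ fun i _ =>
    Submodule.smul_mem _ _ (Submodule.subset_span (Set.mem_range_self i))

variable [IsAlgClosed k] [LocallyOfFiniteType (X ↘ Spec (.of k))]

/-- Modulo the maximal ideal every coefficient is a constant from `k`, by
`exists_sub_baseToStalk_mem`. -/
theorem span_fibre_eq_top (hx : IsClosed {x}) {ι : Type*} {t : ι → 𝒜.Stalk x}
    (ht : Submodule.span (X.presheaf.stalk x) (Set.range t) = ⊤) :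
    Submodule.span k (Set.range fun i => Ideal.Quotient.mk (𝒜.fibreIdeal x) (t i)) = ⊤ := by
  refine top_le_iff.mp fun z _ => ?_
  obtain ⟨s, rfl⟩ := Ideal.Quotient.mk_surjective z
  refine Submodule.span_induction (p := fun s _ => Ideal.Quotient.mk (𝒜.fibreIdeal x) s ∈
    Submodule.span k (Set.range fun i => Ideal.Quotient.mk (𝒜.fibreIdeal x) (t i)))
    ?_ ?_ ?_ ?_ (ht.ge (Submodule.mem_top (x := s)))
  · rintro _ ⟨i, rfl⟩
    exact Submodule.subset_span ⟨i, rfl⟩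
  · rw [map_zero]
    exact zero_mem _
  · intro s t _ _ hs ht
    rw [map_add]
    exact add_mem hs ht
  · intro a s _ hs
    obtain ⟨c, hc⟩ := exists_sub_baseToStalk_mem k hx a
    have h := 𝒜.mk_smul_eq_zero hc s
    rw [sub_smul, map_sub, sub_eq_zero, mk_baseToStalk_smul] at h
    rw [h]
    exact Submodule.smul_mem _ _ hs

theorem finite_fibre (hx : IsClosed {x}) {ι : Type*} [Finite ι] {t : ι → 𝒜.Stalk x}
    (ht : Submodule.span (X.presheaf.stalk x) (Set.range t) = ⊤) :
    Module.Finite k (𝒜.Fibre x) :=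
  ⟨(𝒜.span_fibre_eq_top k hx ht) ▸ Submodule.fg_span (Set.finite_range _)⟩

theorem finrank_fibre_le (hx : IsClosed {x}) {ι : Type*} [Fintype ι] {t : ι → 𝒜.Stalk x}
    (ht : Submodule.span (X.presheaf.stalk x) (Set.range t) = ⊤) :
    Module.finrank k (𝒜.Fibre x) ≤ Fintype.card ι := by
  rw [← finrank_top k, ← 𝒜.span_fibre_eq_top k hx ht]
  exact finrank_range_le_card _

end Fibre

end AlgebraSheaf

/-! ### Spreading generators out from a stalk -/

theorem AlgebraicGeometry.Scheme.exists_opens_forall {X : Scheme.{u}} {ι : Type*} [Finite ι]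
    {P : ι → X.Opens → Prop} (hP : ∀ i U V, V ≤ U → P i U → P i V) {x : X} {W : X.Opens}
    (hx : x ∈ W) (h : ∀ i, ∃ U, x ∈ U ∧ P i U) : ∃ U ≤ W, x ∈ U ∧ ∀ i, P i U := by
  have := Fintype.ofFinite ι
  choose U hxU hU using h
  refine ⟨W ⊓ Finset.univ.inf U, inf_le_left, ⟨hx, ?_⟩, fun i =>
    hP i _ _ (inf_le_right.trans (Finset.inf_le (Finset.mem_univ i))) (hU i)⟩
  rw [TopologicalSpace.Opens.coe_finset_inf]
  simpa using hxU

theorem AlgebraicGeometry.Scheme.exists_germs_eq {X : Scheme.{u}} {ι : Type*} [Finite ι] {x : X}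
    {W : X.Opens} (hx : x ∈ W) (a : ι → X.presheaf.stalk x) :
    ∃ U ≤ W, ∃ (hx : x ∈ U) (b : ι → Γ(X, U)), ∀ i, X.presheaf.germ U x hx (b i) = a i := by
  obtain ⟨U, hU, hxU, h⟩ := X.exists_opens_forall
    (P := fun i U => ∀ hx : x ∈ U, ∃ b : Γ(X, U), X.presheaf.germ U x hx b = a i)
    (fun i U V hVU h hx => by
      obtain ⟨b, hb⟩ := h (hVU hx)
      exact ⟨X.presheaf.map (homOfLE hVU).op b,
        (X.presheaf.germ_res_apply (homOfLE hVU) x hx b).trans hb⟩) hx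
    (fun i => by
      obtain ⟨U, hU, b, hb⟩ := X.presheaf.exists_germ_eq (a i)
      exact ⟨U, hU, fun _ => ⟨b, hb⟩⟩)
  choose b hb using fun i => h i hxU
  exact ⟨U, hU, hxU, b, hb⟩

namespace AlgebraSheaf

open IsLocalRing

variable {X : Scheme.{u}} (𝒜 : AlgebraSheaf X)

theorem exists_germs_eq {ι : Type*} [Finite ι] {x : X}
    {W : X.Opens} (hx : x ∈ W) (t : ι → 𝒜.Stalk x) :
    ∃ U ≤ W, ∃ (hx : x ∈ U) (s : ι → 𝒜.sheaf.obj.obj (op U)), ∀ i, 𝒜.germ U x hx (s i) = t i := by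
  obtain ⟨U, hU, hxU, h⟩ := X.exists_opens_forall
    (P := fun i U => ∀ hx : x ∈ U, ∃ s, 𝒜.germ U x hx s = t i)
    (fun i U V hVU h hx => by
      obtain ⟨s, hs⟩ := h (hVU hx)
      exact ⟨𝒜.res hVU s, (𝒜.germ_res hVU x hx s).trans hs⟩) hx
    (fun i => by
      obtain ⟨U, -, hU, s, hs⟩ := 𝒜.exists_le_germ_eq (t i) (TopologicalSpace.Opens.mem_top x)
      exact ⟨U, hU, fun _ => ⟨s, hs⟩⟩)
  choose s hs using fun i => h i hxU
  exact ⟨U, hU, hxU, s, hs⟩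

theorem exists_forall_res_eq_zero {ι : Type*} [Finite ι] {x : X} {U : X.Opens} (hx : x ∈ U)
    (s : ι → 𝒜.sheaf.obj.obj (op U)) (h : ∀ i, 𝒜.germ U x hx (s i) = 0) :
    ∃ (V : X.Opens) (hV : V ≤ U), x ∈ V ∧ ∀ i, 𝒜.res hV (s i) = 0 := by
  obtain ⟨V, hV, hxV, h⟩ := X.exists_opens_forall
    (P := fun i V => ∃ hV : V ≤ U, 𝒜.res hV (s i) = 0)
    (fun i V V' hle h => by
      obtain ⟨hV, h⟩ := h
      exact ⟨hle.trans hV, by rw [← 𝒜.res_res hV hle, h, map_zero]⟩) hx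
    (fun i => by
      obtain ⟨V, hV, hxV, h0⟩ := 𝒜.exists_le_res_eq_zero hx (s i) (h i)
      exact ⟨V, hxV, hV, h0⟩)
  exact ⟨V, hV, hxV, fun i => (h i).2⟩

/-- A family of sections over `U` generates every stalk at a point of `U`. -/
def Generates {U : X.Opens} {ι : Type*} (s : ι → 𝒜.sheaf.obj.obj (op U)) : Prop :=
  ∀ (y : X) (hy : y ∈ U),
    Submodule.span (X.presheaf.stalk y) (Set.range fun i => 𝒜.germ U y hy (s i)) = ⊤

theorem exists_generates [h : 𝒜.IsCoherent] {x : X} {W : X.Opens} (hx : x ∈ W) :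
    ∃ U ≤ W, x ∈ U ∧ ∃ (m : ℕ) (g : Fin m → 𝒜.sheaf.obj.obj (op U)), 𝒜.Generates g := by
  have := h.isQuasicoherent
  have := h.isFiniteType
  obtain ⟨U, hUW, hU, hxU, hfin⟩ := Scheme.Modules.exists_isAffineOpen_finite 𝒜.toModules hx
  replace hfin : Module.Finite Γ(X, U) (𝒜.sheaf.obj.obj (op U)) := hfin
  have hloc := (𝒜.isLocalizingOn_iff U).mp
    (Scheme.Modules.isLocalizingOn_of_isQuasicoherent _ hU)
  obtain ⟨m, g, hg⟩ := Module.Finite.exists_fin (R := Γ(X, U)) (M := 𝒜.sheaf.obj.obj (op U))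
  refine ⟨U, hUW, hxU, m, g, fun y hy => top_le_iff.mp fun t _ => ?_⟩
  have key (s) : 𝒜.germ U y hy s ∈
      Submodule.span (X.presheaf.stalk y) (Set.range fun i => 𝒜.germ U y hy (g i)) := by
    refine Submodule.span_induction (p := fun s _ => 𝒜.germ U y hy s ∈ Submodule.span
      (X.presheaf.stalk y) (Set.range fun i => 𝒜.germ U y hy (g i))) ?_ ?_ ?_ ?_
      (hg.ge (Submodule.mem_top (x := s)))
    · rintro _ ⟨i, rfl⟩
      exact Submodule.subset_span ⟨i, rfl⟩
    · rw [map_zero]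
      exact zero_mem _
    · intro s t _ _ hs ht
      rw [map_add]
      exact add_mem hs ht
    · intro a s _ hs
      rw [germ_smul]
      exact Submodule.smul_mem _ _ hs
  obtain ⟨V, hV, hyV, s, rfl⟩ := 𝒜.exists_le_germ_eq t hy
  -- A germ at `y` is defined on some `D(f)`; multiplied by a power of `f`, a unit at `y`, it
  -- extends to `U`, where `g` generates.
  obtain ⟨f, hfV, hyf⟩ := hU.exists_basicOpen_le ⟨y, hyV⟩ hy
  obtain ⟨n, t, ht⟩ := hloc.1 f (𝒜.res hfV s)
  have h1 := congr(𝒜.germ _ y hyf $ht)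
  rw [germ_res, germ_smul, germ_res, map_pow, X.presheaf.germ_res_apply] at h1
  have hu : IsUnit (X.presheaf.germ U y hy f ^ n) := ((X.mem_basicOpen f y hy).mp hyf).pow n
  exact (Submodule.smul_mem_iff_of_isUnit _ hu).mp (h1 ▸ key t)

/-- Finitely many sections `g j` generate near `x`. Their expressions in terms of `t` at `x` are
finitely many identities of germs, hence hold on a neighbourhood. -/
theorem exists_generates_germ_eq [h : 𝒜.IsCoherent] {x : X} {W : X.Opens} (hx : x ∈ W)
    {ι : Type*} [Finite ι] (t : ι → 𝒜.Stalk x)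
    (ht : Submodule.span (X.presheaf.stalk x) (Set.range t) = ⊤) :
    ∃ U ≤ W, ∃ (hx : x ∈ U) (s : ι → 𝒜.sheaf.obj.obj (op U)),
      𝒜.Generates s ∧ ∀ i, 𝒜.germ U x hx (s i) = t i := by
  have := Fintype.ofFinite ι
  obtain ⟨U₁, hU₁, hxU₁, m, g, hg⟩ := 𝒜.exists_generates hx
  obtain ⟨U₂, hU₂, hxU₂, s, hs⟩ := 𝒜.exists_germs_eq hxU₁ t
  choose a ha using fun j => (Submodule.mem_span_range_iff_exists_fun _).mp
    (ht.ge (Submodule.mem_top (x := 𝒜.germ U₁ x hxU₁ (g j))))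
  obtain ⟨U₃, hU₃, hxU₃, b, hb⟩ := Scheme.exists_germs_eq hxU₂ (fun q : Fin m × ι => a q.1 q.2)
  obtain ⟨U, hU, hxU, h0⟩ := 𝒜.exists_forall_res_eq_zero hxU₃
    (fun j => ∑ i, b (j, i) • 𝒜.res hU₃ (s i) - 𝒜.res (hU₃.trans hU₂) (g j)) (fun j => by
      rw [map_sub, map_sum, sub_eq_zero]
      simp_rw [germ_smul, germ_res, hb, hs]
      exact ha j)
  have hle := hU.trans hU₃
  refine ⟨U, hle.trans (hU₂.trans hU₁), hxU, fun i => 𝒜.res hle (s i), fun y hy => ?_,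
    fun i => (𝒜.germ_res _ _ _ _).trans (hs i)⟩
  rw [← top_le_iff, ← hg y (hU₂ (hle hy)), Submodule.span_le]
  rintro _ ⟨j, rfl⟩
  have h1 := h0 j
  rw [map_sub, res_res, sub_eq_zero] at h1
  have h2 := congr(𝒜.germ U y hy $h1)
  rw [germ_res, map_sum, germ_res] at h2
  simp only [SetLike.mem_coe]
  rw [← h2]
  refine Submodule.sum_mem _ fun i _ => ?_
  rw [germ_smul, germ_res]
  refine Submodule.smul_mem _ _ (Submodule.subset_span ⟨i, ?_⟩)
  exact 𝒜.germ_res _ _ _ _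

end AlgebraSheaf

theorem Submodule.span_range_ne_eq_top {R M ι : Type*} [CommRing R] [AddCommGroup M] [Module R M]
    [Fintype ι] {t : ι → M} (ht : Submodule.span R (Set.range t) = ⊤) {a : ι → R}
    (h : ∑ i, a i • t i = 0) {j : ι} (hj : IsUnit (a j)) :
    Submodule.span R (Set.range fun i : {i // i ≠ j} => t i) = ⊤ := by
  classical
  rw [← top_le_iff, ← ht, Submodule.span_le]
  rintro _ ⟨i, rfl⟩
  by_cases hi : i = j
  · subst hi
    refine (Submodule.smul_mem_iff_of_isUnit _ hj).mp ?_
    rw [← Finset.add_sum_erase _ _ (Finset.mem_univ i)] at h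
    rw [eq_neg_of_add_eq_zero_left h]
    exact neg_mem (Submodule.sum_mem _ fun l hl => Submodule.smul_mem _ _
      (Submodule.subset_span ⟨⟨l, Finset.ne_of_mem_erase hl⟩, rfl⟩))
  · exact Submodule.subset_span ⟨⟨i, hi⟩, rfl⟩

/-! ### Constant fibre dimension implies freeness -/

namespace AlgebraSheaf

open IsLocalRing

variable {X : Scheme.{u}} (𝒜 : AlgebraSheaf X)

theorem finite_stalk [𝒜.IsCoherent] (x : X) :
    Module.Finite (X.presheaf.stalk x) (𝒜.Stalk x) := by
  obtain ⟨U, -, hxU, m, g, hg⟩ := 𝒜.exists_generates (TopologicalSpace.Opens.mem_top x)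
  exact ⟨(hg x hxU) ▸ Submodule.fg_span (Set.finite_range _)⟩

variable (k : Type u) [Field k] [IsAlgClosed k] [X.Over (Spec (.of k))]
  [LocallyOfFiniteType (X ↘ Spec (.of k))]

/-- A coherent algebra sheaf whose fibres at the closed points near `x` have constant dimension
is free at `x`. -/
theorem free_stalk_of_finrank_fibre_eq [𝒜.IsCoherent] {x : X} (hx : IsClosed {x})
    [IsDomain (X.presheaf.stalk x)] {W : X.Opens} (hxW : x ∈ W) {n : ℕ}
    (hn : ∀ y ∈ W, IsClosed {y} → Module.finrank k (𝒜.Fibre y) = n) :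
    Module.Free (X.presheaf.stalk x) (𝒜.Stalk x) := by
  have : JacobsonSpace X := LocallyOfFiniteType.jacobsonSpace (X ↘ Spec (.of k))
  have := 𝒜.finite_stalk x
  obtain ⟨m, g, hg⟩ := Module.Finite.exists_fin (R := X.presheaf.stalk x) (M := 𝒜.Stalk x)
  have := 𝒜.finite_fibre k hx hg
  obtain ⟨t, ht⟩ := 𝒜.exists_span_stalk_eq_top (x := x) k
  obtain ⟨U, hUW, hxU, s, hs, hst⟩ := 𝒜.exists_generates_germ_eq hxW t ht
  refine Module.Free.of_basis (Module.Basis.mk (v := t) ?_ ht.ge)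
  refine Fintype.linearIndependent_iff.mpr fun a ha j => ?_
  by_contra hj
  obtain ⟨V, hVU, hxV, b, hb⟩ := Scheme.exists_germs_eq hxU a
  obtain ⟨V', hV', hxV', h0⟩ := 𝒜.exists_le_res_eq_zero hxV (∑ i, b i • 𝒜.res hVU (s i)) (by
    simpa only [map_sum, germ_smul, germ_res, hb, hst] using ha)
  -- Closed points are dense in every locally closed subset, so some closed `y` has `b j`
  -- invertible. There the relation eliminates the generator `s j`.
  obtain ⟨y, hyb, hy⟩ := nonempty_inter_closedPoints
    (Scheme.basicOpen_nonempty_of_germ_ne_zero hxV' (X.presheaf.map (homOfLE hV').op (b j))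
      (by rwa [X.presheaf.germ_res_apply, hb])) (TopologicalSpace.Opens.isOpen _).isLocallyClosed
  have hyV' : y ∈ V' := X.basicOpen_le _ hyb
  have hu := (X.mem_basicOpen _ y hyV').mp hyb
  rw [X.presheaf.germ_res_apply] at hu
  have h1 := congr(𝒜.germ V' y hyV' $h0)
  rw [germ_res, map_sum, map_zero] at h1
  simp_rw [germ_smul, germ_res] at h1
  have h2 := 𝒜.finrank_fibre_le k hy (Submodule.span_range_ne_eq_top (hs y (hVU (hV' hyV'))) h1 hu)
  rw [hn y (hUW (hVU (hV' hyV'))) hy, Fintype.card_subtype_compl, Fintype.card_fin,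
    Fintype.card_subtype_eq, hn x hxW hx] at h2
  -- The bound reads `n ≤ n - 1` with truncated subtraction; the index `j` shows that `n` is
  -- positive.
  have := hn x hxW hx ▸ j.pos
  omega

end AlgebraSheaf

/-! ### Flatness of the quotient and conclusion -/

theorem Module.Flat.of_isField {R : Type*} [CommRing R] (h : IsField R) (M : Type*)
    [AddCommGroup M] [Module R M] : Module.Flat R M := by
  let := h.toField
  have : Module.Free R M := Module.Free.of_divisionRing R M
  exact Module.Flat.of_free

namespace AlgebraSheaf

open IsLocalRing
open Scheme (puncture)

variable {k : Type u} [Field k] {X : Scheme.{u}} [X.Over (Spec (.of k))]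

/-- A non-closed point specializes to a closed one, since `X` is Jacobson, and on a non-singular
curve its local ring is then a field. -/
theorem flat_stalk_of_not_isClosed [h : IsNonsingularCurve k X] (𝒜 : AlgebraSheaf X) {x : X}
    (hx : ¬ IsClosed {x}) : Module.Flat (X.presheaf.stalk x) (𝒜.Stalk x) := by
  have := h.locallyOfFiniteType
  have : JacobsonSpace X := LocallyOfFiniteType.jacobsonSpace (X ↘ Spec (.of k))
  obtain ⟨y, hxy, hy⟩ := nonempty_inter_closedPoints (Z := closure {x})
    ⟨x, subset_closure rfl⟩ isClosed_closure.isLocallyClosed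
  have := h.isRegularLocalRing_stalk y hy
  obtain ⟨ϖ, hϖ⟩ := IsRegularLocalRing.exists_maximalIdeal_eq_span_singleton
    (X.presheaf.stalk y) (h.ringKrullDim_stalk y hy)
  have hne : x ≠ y := by
    rintro rfl
    exact hx hy
  exact .of_isField
    (Scheme.isField_stalk_of_specializes hy (specializes_iff_mem_closure.mpr hxy) hne hϖ) _

theorem punctureImage_isFlat [IsAlgClosed k] [h : IsNonsingularCurve k X] {p : X} (hp : IsClosed {p})
    (𝒜 : AlgebraSheaf X) [𝒜.IsCoherent] {n : ℕ}
    (hn : ∀ x : X, IsClosed {x} → x ≠ p → Module.finrank k (𝒜.Fibre x) = n) :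
    (𝒜.punctureImage hp).IsFlat where
  flat_stalk x := by
    have := h.locallyOfFiniteType
    have : IsLocallyNoetherian X := LocallyOfFiniteType.isLocallyNoetherian (X ↘ Spec (.of k))
    by_cases hx : IsClosed {x}
    swap
    · exact flat_stalk_of_not_isClosed (k := k) _ hx
    have := h.isRegularLocalRing_stalk x hx
    have : IsDomain (X.presheaf.stalk x) :=
      IsRegularLocalRing.isDomain_of_ringKrullDim_eq_one _ (h.ringKrullDim_stalk x hx)
    by_cases hxp : x = p
    · subst hxp
      obtain ⟨ϖ, hϖ⟩ := IsRegularLocalRing.exists_maximalIdeal_eq_span_singleton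
        (X.presheaf.stalk x) (h.ringKrullDim_stalk x hx)
      exact Module.Flat.of_isSMulRegular_uniformizer hϖ
        (𝒜.isSMulRegular_stalk_punctureImage hp hϖ)
    · have := 𝒜.free_stalk_of_finrank_fibre_eq k hx (W := puncture hp) hxp
        fun y hy hy' => hn y hy' hy
      exact Module.Flat.of_linearEquiv (AlgEquiv.ofBijective
        (stalkAlgHom (𝒜.toPunctureImage hp) (𝒜.structureHom_toPunctureImage hp) x)
        (𝒜.stalkRingHom_toPunctureImage_bijective hp hxp)).symm.toLinearEquiv

end AlgebraSheaf

theorem mainTheorem8 {k : Type u} [Field k] [IsAlgClosed k]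
    (X : Scheme.{u}) [X.Over (Spec (.of k))] [IsNonsingularCurve k X]
    (p : X) (hp : IsClosed {p})
    {A : Type v} [Ring A] [Algebra k A] {B : Type w} [Ring B] [Algebra k B]
    (𝒜 : AlgebraSheaf X) [𝒜.IsCoherent]
    (hB : ∀ x : X, IsClosed {x} → x ≠ p → Nonempty (𝒜.Fibre x ≃ₐ[k] B))
    (hA : Nonempty (𝒜.Fibre p ≃ₐ[k] A)) :
    ∃ ℬ : AlgebraSheaf X, ℬ.IsCoherent ∧ ℬ.IsFlat ∧
      (∀ x : X, IsClosed {x} → x ≠ p → Nonempty (ℬ.Fibre x ≃ₐ[k] B)) ∧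
      ∃ (I : Ideal A) (_ : I.IsTwoSided), Nonempty (ℬ.Fibre p ≃ₐ[k] A ⧸ I) := by
  have := IsNonsingularCurve.locallyOfFiniteType (k := k) (X := X)
  have : IsLocallyNoetherian X := LocallyOfFiniteType.isLocallyNoetherian (X ↘ Spec (.of k))
  have := IsNonsingularCurve.isRegularLocalRing_stalk (k := k) p hp
  obtain ⟨ϖ, hϖ⟩ := IsRegularLocalRing.exists_maximalIdeal_eq_span_singleton
    (X.presheaf.stalk p) (IsNonsingularCurve.ringKrullDim_stalk (k := k) p hp)
  have hf := 𝒜.structureHom_toPunctureImage hp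
  refine ⟨𝒜.punctureImage hp, 𝒜.punctureImage_isCoherent hp hϖ,
    AlgebraSheaf.punctureImage_isFlat (k := k) (n := Module.finrank k B) hp 𝒜
      fun x hx hxp => ?_, fun x hx hxp => ?_, ?_⟩
  · obtain ⟨e⟩ := hB x hx hxp
    exact e.toLinearEquiv.finrank_eq
  · obtain ⟨e⟩ := hB x hx hxp
    exact ⟨(AlgEquiv.ofBijective _ (AlgebraSheaf.fibreAlgHom_bijective (k := k) _ hf x
      (𝒜.stalkRingHom_toPunctureImage_bijective hp hxp))).symm.trans e⟩
  · obtain ⟨e⟩ := hA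
    -- The ideal `I` is the kernel of the surjection from `A ≃ 𝒜(p)` onto the new fibre at `p`.
    let g := (AlgebraSheaf.fibreAlgHom (k := k) _ hf p).comp e.symm.toAlgHom
    have hg : Function.Surjective g := (AlgebraSheaf.fibreAlgHom_surjective (k := k) _ hf p
      (AlgebraSheaf.stalkRingHom_surjective _ (𝒜.toPunctureImage_surjective hp) p)).comp
      e.symm.surjective
    exact ⟨RingHom.ker g, inferInstance, ⟨(Ideal.quotientKerAlgEquivOfSurjective hg).symm⟩⟩
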